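/- Let $\mathsf{R}$ be a finite set of pairwise disjoint open axis-aligned rectangles in the plane, let $\mathsf{F}=\mathbb{R}^2\setminus\bigcup_{R\in\mathsf{R}}R$ be the free space, and let $\mathsf{S}\subset\mathsf{F}$ be a finite set of point sites. Write $x(p),y(p)$ for the coordinates of a point $p$. For $p,q\in\mathsf{F}$ let $d(p,q)$ be the geodesic $L_1$ distance, i.e. the infimum of the $L_1$ lengths of the paths from $p$ to $q$ contained in $\mathsf{F}$, and let $f(p)$ be the set of sites $s\in\mathsf{S}$ with $d(s,p)\ge d(s',p)$ for all $s'\in\mathsf{S}$. For $s\in\mathsf{F}$ let $\pi_{\mathsf{ru}}(s)$ be the path from $s$ that goes horizontally rightwards until it is stopped by a rectangle of $\mathsf{R}$, then goes up along the left side of that rectangle to its top-left corner, then again horizontally rightwards, and so on; let $\pi_{\mathsf{lu}}(s)$ be its mirror image, going leftwards and up to top-right corners. A point $p\in\mathsf{F}$ is $y^+$-reachable from $s$ if it lies on or above the curve $\pi_{\mathsf{lu}}(s)\cup\pi_{\mathsf{ru}}(s)$. The cell of a site $s$ in the farthest-point map $\mathsf{M}_{y^+}$ is the set of the points $p\in\mathsf{F}$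 that are $y^+$-reachable from $s$ and satisfy $d(p,s)>d(p,s')$ for every site $s'\ne s$ from which $p$ is $y^+$-reachable. Let $pq$ be a horizontal segment contained in $\mathsf{F}$ with $x(p)<x(q)$. (1) Let $f_p\in f(p)$ and $f_q\in f(q)$ be such that $p$ and $q$ are both $y^+$-reachable from both $f_p$ and $f_q$. If $f_p\notin f(q)$ or $f_q\notin f(p)$, then $x(f_p)>x(f_q)$. (2) Consequently the cells of $\mathsf{M}_{y^+}$ appear along $pq$ in reverse order of their sites: if $a,b$ are points of $pq$ with $x(a)<x(b)$ and $a$ lies in the cell of a site $s$ and $b$ in the cell of a site $s'\neq s$, then $x(s)>x(s')$. -/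

import Mathlib

noncomputable section

namespace RectFVD

/-- The plane with the `L₁` metric; the coordinates of `p` are `p.fst` and `p.snd`. -/
abbrev Plane := WithLp 1 (ℝ × ℝ)

/-- The point with coordinates `(x, y)`. -/
def pt (x y : ℝ) : Plane := WithLp.toLp 1 (x, y)

/-- A (bounded, nondegenerate) axis-aligned rectangle. -/
structure Rect where
  x₁ : ℝ
  x₂ : ℝ
  y₁ : ℝ
  y₂ : ℝ
  hx : x₁ < x₂
  hy : y₁ < y₂

/-- The open rectangle `(x₁, x₂) × (y₁, y₂)`. -/
def Rect.openSet (r : Rect) : Set Plane :=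
  {p | r.x₁ < p.fst ∧ p.fst < r.x₂ ∧ r.y₁ < p.snd ∧ p.snd < r.y₂}

/-- The free space: the plane minus the open rectangular obstacles. -/
def freeSpace (R : Finset Rect) : Set Plane := (⋃ r ∈ R, r.openSet)ᶜ

/-- The geodesic distance: the infimum of the `L₁` lengths of the continuous paths from `p` to `q`
that stay in the free space. -/
def geodesicDist (R : Finset Rect) (p q : Plane) : ENNReal :=
  ⨅ (γ : Path p q) (_ : Set.range γ ⊆ freeSpace R), eVariationOn γ Set.univ

/-- The points of the horizontal ray that starts at `a` and goes rightwards until it is stopped by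
an obstacle (the stopping point included). -/
def rayRight (R : Finset Rect) (a : Plane) : Set Plane :=
  {c | c.snd = a.snd ∧ a.fst ≤ c.fst ∧ ∀ t ∈ Set.Icc a.fst c.fst, pt t a.snd ∈ freeSpace R}

/-- The points of the horizontal ray that starts at `a` and goes leftwards until it is stopped by
an obstacle (the stopping point included). -/
def rayLeft (R : Finset Rect) (a : Plane) : Set Plane :=
  {c | c.snd = a.snd ∧ c.fst ≤ a.fst ∧ ∀ t ∈ Set.Icc c.fst a.fst, pt t a.snd ∈ freeSpace R}

/-- The rightward ray from `a` is stopped by the obstacle `r`, at a point of the left side of `r`.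
(A ray that only runs along the boundary of an open obstacle is not stopped by it.) -/
def HitsRight (R : Finset Rect) (a : Plane) (r : Rect) : Prop :=
  r ∈ R ∧ r.y₁ < a.snd ∧ a.snd < r.y₂ ∧ pt r.x₁ a.snd ∈ rayRight R a

/-- The leftward ray from `a` is stopped by the obstacle `r`, at a point of the right side of
`r`. -/
def HitsLeft (R : Finset Rect) (a : Plane) (r : Rect) : Prop :=
  r ∈ R ∧ r.y₁ < a.snd ∧ a.snd < r.y₂ ∧ pt r.x₂ a.snd ∈ rayLeft R a

/-- The points `p₁ = s, p₂, p₃, …` at which a horizontal ray of the rightwards-upwards path from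
`s` starts: `s` itself, and then the top-left corner of each rectangle that stops a ray. -/
inductive RUStart (R : Finset Rect) (s : Plane) : Plane → Prop
  | base : RUStart R s s
  | step (a : Plane) (r : Rect) : RUStart R s a → HitsRight R a r → RUStart R s (pt r.x₁ r.y₂)

/-- The points at which a horizontal ray of the leftwards-upwards path from `s` starts: `s` itself,
and then the top-right corner of each rectangle that stops a ray. -/
inductive LUStart (R : Finset Rect) (s : Plane) : Plane → Prop
  | base : LUStart R s s
  | step (a : Plane) (r : Rect) : LUStart R s a → HitsLeft R a r → LUStart R s (pt r.x₂ r.y₂)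

/-- The rightwards-upwards path `π_ru(s)`: horizontal rays going rightwards, each followed, if it is
stopped by a rectangle, by the vertical segment up to the top-left corner of that rectangle. -/
def piRU (R : Finset Rect) (s : Plane) : Set Plane :=
  {c | ∃ a, RUStart R s a ∧ (c ∈ rayRight R a ∨
    ∃ r, HitsRight R a r ∧ c.fst = r.x₁ ∧ a.snd ≤ c.snd ∧ c.snd ≤ r.y₂)}

/-- The leftwards-upwards path `π_lu(s)`: horizontal rays going leftwards, each followed, if it is
stopped by a rectangle, by the vertical segment up to the top-right corner of that rectangle. -/
def piLU (R : Finset Rect) (s : Plane) : Set Plane :=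
  {c | ∃ a, LUStart R s a ∧ (c ∈ rayLeft R a ∨
    ∃ r, HitsLeft R a r ∧ c.fst = r.x₂ ∧ a.snd ≤ c.snd ∧ c.snd ≤ r.y₂)}

/-- `p` is `y⁺`-reachable from `s`: `p` is a point of the free space lying on or above the
`x`-monotone curve `π_lu(s) ∪ π_ru(s)`. -/
def YPlusReachable (R : Finset Rect) (s p : Plane) : Prop :=
  p ∈ freeSpace R ∧ ∃ c ∈ piLU R s ∪ piRU R s, c.fst = p.fst ∧ c.snd ≤ p.snd

/-- The set `f(p)` of the sites that are farthest from `p` (among all sites). -/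
def farthestSites (R : Finset Rect) (S : Finset Plane) (p : Plane) : Set Plane :=
  {s | s ∈ S ∧ ∀ s' ∈ S, geodesicDist R s' p ≤ geodesicDist R s p}

/-- The cell (possibly disconnected or empty) of the site `s` in the farthest-point map of the
positive `y`-direction: the points `y⁺`-reachable from `s` that are strictly farther from `s` than
from every other site from which they are `y⁺`-reachable. -/
def yPlusCell (R : Finset Rect) (S : Finset Plane) (s : Plane) : Set Plane :=
  {p | s ∈ S ∧ YPlusReachable R s p ∧
    ∀ s' ∈ S, s' ≠ s → YPlusReachable R s' p → geodesicDist R p s' < geodesicDist R p s}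

end RectFVD

end

namespace RectFVD

/-! Both claims reduce to `fst_lt_of_farther`: on a free horizontal segment with left end u and
right end v, if s is at least as far from u as s', and s' at least as far from v as s, one of them
strictly, then s lies strictly to the right of s'. Suppose instead that s is not to the right of s'.
Nearly shortest paths from s to v and from s' to u then ought to cross, and exchanging their tails
gives d(s,u) + d(s',v) ≤ d(s,v) + d(s',u), a contradiction.

The crossing needs paths that never go down. `FreePath.exists_upPath` supplies them: a point
y⁺-reachable from a site is joined to it by an upward path no longer than any given free rectilinear
path. `exists_freePath` passes from continuous paths to rectilinear ones.

Sites at different heights may prevent the crossing: the path from the lower site can pass on the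
far side of the higher one. By reachability it then meets a staircase from the higher site, which is
thus closer to its end by at least the L₁ distance of the sites (`UpPath.exchange`). This too
contradicts the assumed order of distances.

Reachability from a site is constant along a free horizontal segment (`YPlusReachable.horiz`), so
the two sites can be compared at both ends. -/

/-- The point `(x, y)` lies in no open rectangle of `R`. -/
def Free (R : Finset Rect) (x y : ℝ) : Prop :=
  ∀ r ∈ R, ¬ (r.x₁ < x ∧ x < r.x₂ ∧ r.y₁ < y ∧ y < r.y₂)

theorem pt_mem_freeSpace {R : Finset Rect} {x y : ℝ} : pt x y ∈ freeSpace R ↔ Free R x y := by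
  simp [freeSpace, Free, Rect.openSet, pt]

/-- The horizontal segment at height `y` between `x` and `x'` is free. -/
def HFree (R : Finset Rect) (y x x' : ℝ) : Prop := ∀ t ∈ Set.uIcc x x', Free R t y

/-- The vertical segment at abscissa `x` between `y` and `y'` is free. -/
def VFree (R : Finset Rect) (x y y' : ℝ) : Prop := ∀ t ∈ Set.uIcc y y', Free R x t

theorem HFree.mono {R : Finset Rect} {y x x' a b : ℝ} (h : HFree R y x x')
    (ha : a ∈ Set.uIcc x x') (hb : b ∈ Set.uIcc x x') : HFree R y a b :=
  fun t ht => h t (Set.uIcc_subset_uIcc ha hb ht)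

theorem VFree.mono {R : Finset Rect} {x y y' a b : ℝ} (h : VFree R x y y')
    (ha : a ∈ Set.uIcc y y') (hb : b ∈ Set.uIcc y y') : VFree R x a b :=
  fun t ht => h t (Set.uIcc_subset_uIcc ha hb ht)

theorem HFree.symm {R : Finset Rect} {y x x' : ℝ} (h : HFree R y x x') : HFree R y x' x :=
  h.mono Set.right_mem_uIcc Set.left_mem_uIcc

theorem VFree.symm {R : Finset Rect} {x y y' : ℝ} (h : VFree R x y y') : VFree R x y' y :=
  h.mono Set.right_mem_uIcc Set.left_mem_uIcc

theorem abs_sub_add_abs_sub_of_mem_uIcc {x x' w : ℝ} (h : w ∈ Set.uIcc x x') :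
    |w - x| + |x' - w| = |x' - x| := by
  rcases Set.mem_uIcc.1 h with ⟨h1, h2⟩ | ⟨h1, h2⟩
  · rw [abs_of_nonneg (by linarith), abs_of_nonneg (by linarith), abs_of_nonneg (by linarith)]
    ring
  · rw [abs_of_nonpos (by linarith), abs_of_nonpos (by linarith), abs_of_nonpos (by linarith)]
    ring

/-! ### Upward paths and their crossings -/

/-- `UpPath R x₀ y₀ x y ℓ`: a free rectilinear path of length `ℓ` leads from `(x₀, y₀)` to `(x, y)`
and never goes down. -/
inductive UpPath (R : Finset Rect) (x₀ y₀ : ℝ) : ℝ → ℝ → ℝ → Prop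
  | refl : UpPath R x₀ y₀ x₀ y₀ 0
  | horiz {x y ℓ : ℝ} (x' : ℝ) : UpPath R x₀ y₀ x y ℓ → HFree R y x x' →
      UpPath R x₀ y₀ x' y (ℓ + |x' - x|)
  | up {x y ℓ : ℝ} (y' : ℝ) : UpPath R x₀ y₀ x y ℓ → y ≤ y' → VFree R x y y' →
      UpPath R x₀ y₀ x y' (ℓ + (y' - y))

namespace UpPath

variable {R : Finset Rect}

theorem cast {a b x y ℓ ℓ' : ℝ} (h : UpPath R a b x y ℓ) (e : ℓ = ℓ') : UpPath R a b x y ℓ' :=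
  e ▸ h

theorem single_horiz {y x x' : ℝ} (h : HFree R y x x') : UpPath R x y x' y |x' - x| :=
  (horiz x' refl h).cast (zero_add _)

theorem single_up {x y y' : ℝ} (hy : y ≤ y') (h : VFree R x y y') : UpPath R x y x y' (y' - y) :=
  (up y' refl hy h).cast (zero_add _)

theorem trans {a b x y x' y' ℓ ℓ' : ℝ} (h : UpPath R a b x y ℓ) (h' : UpPath R x y x' y' ℓ') :
    UpPath R a b x' y' (ℓ + ℓ') := by
  induction h' with
  | refl => exact h.cast (by ring)
  | horiz x'' _ hf ih => exact (horiz x'' ih hf).cast (by ring)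
  | up y'' _ hy hf ih => exact (up y'' ih hy hf).cast (by ring)

theorem le_snd {a b x y ℓ : ℝ} (h : UpPath R a b x y ℓ) : b ≤ y := by
  induction h with
  | refl => exact le_rfl
  | horiz _ _ _ ih => exact ih
  | up _ _ hy _ ih => exact ih.trans hy

theorem dist_le {a b x y ℓ : ℝ} (h : UpPath R a b x y ℓ) : |x - a| + (y - b) ≤ ℓ := by
  induction h with
  | refl => simp
  | @horiz x y ℓ x' _ _ ih => linarith [abs_sub_le x' x a]
  | up _ _ _ _ ih => linarith

theorem exists_snd_eq {a b x y ℓ h : ℝ} (p : UpPath R a b x y ℓ) (h₁ : b ≤ h) (h₂ : h ≤ y) :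
    ∃ w ℓ₁ ℓ₂, UpPath R a b w h ℓ₁ ∧ UpPath R w h x y ℓ₂ ∧ ℓ₁ + ℓ₂ = ℓ := by
  induction p with
  | refl =>
    obtain rfl : h = b := le_antisymm h₂ h₁
    exact ⟨a, 0, 0, refl, refl, by ring⟩
  | horiz x' _ hf ih =>
    obtain ⟨w, ℓ₁, ℓ₂, p₁, p₂, e⟩ := ih h₂
    exact ⟨w, ℓ₁, _, p₁, horiz x' p₂ hf, by linarith⟩
  | @up x y ℓ y' p hy hf ih =>
    rcases le_total h y with hh | hh
    · obtain ⟨w, ℓ₁, ℓ₂, p₁, p₂, e⟩ := ih hh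
      exact ⟨w, ℓ₁, _, p₁, up y' p₂ hy hf, by linarith⟩
    · have hm : h ∈ Set.uIcc y y' := Set.mem_uIcc.2 (.inl ⟨hh, h₂⟩)
      exact ⟨x, _, _, up h p hh (hf.mono Set.left_mem_uIcc hm),
        single_up h₂ (hf.mono hm Set.right_mem_uIcc), by ring⟩

/-- A discrete intermediate value theorem, for leftward passages only; mirroring covers the others.
-/
theorem exists_fst_eq {a b x y ℓ w : ℝ} (p : UpPath R a b x y ℓ) (h₁ : w ≤ a) (h₂ : x ≤ w) :
    ∃ h ℓ₁ ℓ₂, UpPath R a b w h ℓ₁ ∧ UpPath R w h x y ℓ₂ ∧ ℓ₁ + ℓ₂ = ℓ := by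
  induction p with
  | refl =>
    obtain rfl : w = a := le_antisymm h₁ h₂
    exact ⟨b, 0, 0, refl, refl, by ring⟩
  | @horiz x y ℓ x' p hf ih =>
    rcases le_total x w with hh | hh
    · obtain ⟨h, ℓ₁, ℓ₂, p₁, p₂, e⟩ := ih hh
      exact ⟨h, ℓ₁, _, p₁, horiz x' p₂ hf, by linarith⟩
    · have hm : w ∈ Set.uIcc x x' := Set.mem_uIcc.2 (.inr ⟨h₂, hh⟩)
      exact ⟨y, _, _, horiz w p (hf.mono Set.left_mem_uIcc hm),
        single_horiz (hf.mono hm Set.right_mem_uIcc),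
        by linarith [abs_sub_add_abs_sub_of_mem_uIcc hm]⟩
  | @up x y ℓ y' p hy hf ih =>
    obtain ⟨h, ℓ₁, ℓ₂, p₁, p₂, e⟩ := ih h₂
    exact ⟨h, ℓ₁, _, p₁, up y' p₂ hy hf, by linarith⟩

/-- Two upward paths between the same heights whose ends are in opposite order meet. -/
theorem exists_common {a b h x y ℓ x' ℓ' : ℝ} (p : UpPath R a h x y ℓ) (p' : UpPath R b h x' y ℓ')
    (hab : a ≤ b) (hx : x' ≤ x) :
    ∃ w v ℓ₁ ℓ₂ ℓ₁' ℓ₂', UpPath R a h w v ℓ₁ ∧ UpPath R w v x y ℓ₂ ∧ UpPath R b h w v ℓ₁' ∧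
      UpPath R w v x' y ℓ₂' ∧ ℓ₁ + ℓ₂ = ℓ ∧ ℓ₁' + ℓ₂' = ℓ' := by
  induction p generalizing x' ℓ' with
  | refl =>
    obtain ⟨v, ℓ₁, ℓ₂, p₁, p₂, e⟩ := p'.exists_fst_eq hab hx
    obtain rfl : v = h := le_antisymm p₂.le_snd p₁.le_snd
    exact ⟨a, v, 0, 0, ℓ₁, ℓ₂, refl, refl, p₁, p₂, by ring, e⟩
  | @horiz x y ℓ x'' p hf ih =>
    rcases le_total x' x with hh | hh
    · obtain ⟨w, v, ℓ₁, ℓ₂, ℓ₁', ℓ₂', q₁, q₂, q₁', q₂', e, e'⟩ := ih p' hh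
      exact ⟨w, v, ℓ₁, _, ℓ₁', ℓ₂', q₁, horiz x'' q₂ hf, q₁', q₂', by linarith, e'⟩
    · have hm : x' ∈ Set.uIcc x x'' := Set.mem_uIcc.2 (.inl ⟨hh, hx⟩)
      exact ⟨x', y, _, _, ℓ', 0, horiz x' p (hf.mono Set.left_mem_uIcc hm),
        single_horiz (hf.mono hm Set.right_mem_uIcc), p', refl,
        by linarith [abs_sub_add_abs_sub_of_mem_uIcc hm], by ring⟩
  | @up x y ℓ y' p hy hf ih =>
    -- Cut `p'` at the height where the last vertical piece of `p` begins. Either the order is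
    -- already reversed there, and the paths met before, or the rest of `p'` must cross this
    -- vertical piece.
    obtain ⟨w, m₁, m₂, q₁, q₂, e⟩ := p'.exists_snd_eq p.le_snd hy
    rcases le_total w x with hh | hh
    · obtain ⟨u, v, ℓ₁, ℓ₂, ℓ₁', ℓ₂', r₁, r₂, r₁', r₂', e, e'⟩ := ih q₁ hh
      exact ⟨u, v, ℓ₁, _, ℓ₁', _, r₁, up y' r₂ hy hf, r₁', r₂'.trans q₂, by linarith, by linarith⟩
    · obtain ⟨v, n₁, n₂, r₁, r₂, e'⟩ := q₂.exists_fst_eq hh hx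
      have hm : v ∈ Set.uIcc y y' := Set.mem_uIcc.2 (.inl ⟨r₁.le_snd, r₂.le_snd⟩)
      exact ⟨x, v, _, _, _, n₂, up v p r₁.le_snd (hf.mono Set.left_mem_uIcc hm),
        single_up r₂.le_snd (hf.mono hm Set.right_mem_uIcc), q₁.trans r₁, r₂,
        by ring, by linarith⟩

end UpPath

/-! ### Obstacles and the mirror symmetry -/

/-- No two different rectangles of `R` overlap. -/
def Nonoverlapping (R : Finset Rect) : Prop :=
  ∀ r ∈ R, ∀ r' ∈ R, r.x₁ < r'.x₂ → r'.x₁ < r.x₂ → r.y₁ < r'.y₂ → r'.y₁ < r.y₂ → r = r'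

theorem nonoverlapping_of_pairwiseDisjoint {R : Finset Rect}
    (hR : (R : Set Rect).PairwiseDisjoint Rect.openSet) : Nonoverlapping R := by
  intro r hr r' hr' h1 h2 h3 h4
  by_contra hne
  obtain ⟨x, hx1, hx2⟩ : ∃ x, max r.x₁ r'.x₁ < x ∧ x < min r.x₂ r'.x₂ :=
    exists_between (by simp [r.hx, r'.hx, h1, h2])
  obtain ⟨y, hy1, hy2⟩ : ∃ y, max r.y₁ r'.y₁ < y ∧ y < min r.y₂ r'.y₂ :=
    exists_between (by simp [r.hy, r'.hy, h3, h4])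
  rw [max_lt_iff] at hx1 hy1
  rw [lt_min_iff] at hx2 hy2
  exact Set.disjoint_left.1 (hR hr hr' hne) (show pt x y ∈ _ from ⟨hx1.1, hx2.1, hy1.1, hy2.1⟩)
    ⟨hx1.2, hx2.2, hy1.2, hy2.2⟩

/-- The mirror image of a rectangle under `x ↦ -x`. -/
def Rect.mirror (r : Rect) : Rect := ⟨-r.x₂, -r.x₁, r.y₁, r.y₂, neg_lt_neg r.hx, r.hy⟩

theorem Rect.mirror_mirror (r : Rect) : r.mirror.mirror = r := by
  cases r; simp [Rect.mirror]

/-- The mirror image of a set of rectangles under `x ↦ -x`. -/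
def mirrorSet (R : Finset Rect) : Finset Rect :=
  R.map ⟨Rect.mirror, Function.LeftInverse.injective Rect.mirror_mirror⟩

theorem mirror_mem {R : Finset Rect} {r : Rect} (h : r ∈ R) : r.mirror ∈ mirrorSet R :=
  Finset.mem_map_of_mem _ h

theorem mirrorSet_mirrorSet (R : Finset Rect) : mirrorSet (mirrorSet R) = R := by
  ext r
  simp [mirrorSet, Rect.mirror_mirror]

theorem mem_mirrorSet {R : Finset Rect} {r : Rect} (h : r ∈ mirrorSet R) : r.mirror ∈ R := by
  simpa [mirrorSet_mirrorSet] using mirror_mem h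

theorem Nonoverlapping.mirror {R : Finset Rect} (h : Nonoverlapping R) :
    Nonoverlapping (mirrorSet R) := by
  intro r hr r' hr' h1 h2 h3 h4
  have := h _ (mem_mirrorSet hr) _ (mem_mirrorSet hr') (neg_lt_neg h2) (neg_lt_neg h1) h3 h4
  rw [← r.mirror_mirror, this, Rect.mirror_mirror]

theorem Free.mirror {R : Finset Rect} {x y : ℝ} (h : Free R x y) : Free (mirrorSet R) (-x) y := by
  rintro r hr ⟨h1, h2, h3, h4⟩
  exact h _ (mem_mirrorSet hr) ⟨by simp only [Rect.mirror]; linarith,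
    by simp only [Rect.mirror]; linarith, h3, h4⟩

theorem HFree.mirror {R : Finset Rect} {y x x' : ℝ} (h : HFree R y x x') :
    HFree (mirrorSet R) y (-x) (-x') := by
  intro t ht
  have := (h (-t) (by
    rw [Set.mem_uIcc] at ht ⊢
    rcases ht with ht | ht
    · exact .inr ⟨by linarith, by linarith⟩
    · exact .inl ⟨by linarith, by linarith⟩)).mirror
  rwa [neg_neg] at this

theorem UpPath.mirror {R : Finset Rect} {a b x y ℓ : ℝ} (h : UpPath R a b x y ℓ) :
    UpPath (mirrorSet R) (-a) b (-x) y ℓ := by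
  induction h with
  | refl => exact refl
  | @horiz x y ℓ x' _ hf ih =>
    exact (horiz (-x') ih hf.mirror).cast (by rw [← abs_neg (-x' - -x)]; ring_nf)
  | up y' _ hy hf ih => exact up y' ih hy fun t ht => (hf t ht).mirror

theorem UpPath.of_mirror {R : Finset Rect} {a b x y ℓ : ℝ}
    (h : UpPath (mirrorSet R) (-a) b (-x) y ℓ) : UpPath R a b x y ℓ := by
  simpa [mirrorSet_mirrorSet] using h.mirror

/-- A different rectangle containing a point of a side in its interior would overlap the rectangle
itself. -/
theorem Nonoverlapping.free_top {R : Finset Rect} (hR : Nonoverlapping R) {r : Rect} (hr : r ∈ R)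
    {t : ℝ} (h₁ : r.x₁ ≤ t) (h₂ : t ≤ r.x₂) : Free R t r.y₂ := by
  rintro r' hr' ⟨h1, h2, h3, h4⟩
  have := r.hy
  obtain rfl := hR r hr r' hr' (by linarith) (by linarith) (by linarith) h3
  exact lt_irrefl _ h4

theorem Nonoverlapping.free_left {R : Finset Rect} (hR : Nonoverlapping R) {r : Rect} (hr : r ∈ R)
    {t : ℝ} (h₁ : r.y₁ ≤ t) (h₂ : t ≤ r.y₂) : Free R r.x₁ t := by
  rintro r' hr' ⟨h1, h2, h3, h4⟩
  have := r.hx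
  obtain rfl := hR r hr r' hr' (by linarith) (by linarith) (by linarith) (by linarith)
  exact lt_irrefl _ h1

/-! ### The curves as staircases -/

theorem mem_rayRight {R : Finset Rect} {a c : Plane} : c ∈ rayRight R a ↔
    c.snd = a.snd ∧ a.fst ≤ c.fst ∧ HFree R a.snd a.fst c.fst := by
  refine and_congr_right fun _ => and_congr_right fun h => ?_
  simp only [HFree, Set.uIcc_of_le h, pt_mem_freeSpace]

theorem mem_rayLeft {R : Finset Rect} {a c : Plane} : c ∈ rayLeft R a ↔
    c.snd = a.snd ∧ c.fst ≤ a.fst ∧ HFree R a.snd a.fst c.fst := by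
  refine and_congr_right fun _ => and_congr_right fun h => ?_
  simp only [HFree, Set.uIcc_of_ge h, pt_mem_freeSpace]

/-- A length equal to the L₁ distance of the ends encodes that the path is monotone in both
coordinates. -/
theorem RUStart.upPath {R : Finset Rect} (hR : Nonoverlapping R) {s a : Plane}
    (h : RUStart R s a) : s.fst ≤ a.fst ∧
      UpPath R s.fst s.snd a.fst a.snd (a.fst - s.fst + (a.snd - s.snd)) := by
  induction h with
  | base => exact ⟨le_rfl, UpPath.refl.cast (by ring)⟩
  | step a r _ hr ih =>
    obtain ⟨hr, h1, h2, h3⟩ := hr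
    obtain ⟨-, h4, h5⟩ := mem_rayRight.1 h3
    refine ⟨ih.1.trans h4, ((ih.2.horiz _ h5).up r.y₂ h2.le fun t ht => ?_).cast ?_⟩
    · rw [Set.uIcc_of_le h2.le] at ht
      exact hR.free_left hr (h1.le.trans ht.1) ht.2
    · change a.fst ≤ r.x₁ at h4
      change _ + |r.x₁ - a.fst| + _ = r.x₁ - s.fst + (r.y₂ - s.snd)
      rw [abs_of_nonneg (by linarith)]
      ring

theorem upPath_of_mem_piRU {R : Finset Rect} (hR : Nonoverlapping R) {s c : Plane}
    (h : c ∈ piRU R s) : s.fst ≤ c.fst ∧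
      UpPath R s.fst s.snd c.fst c.snd (c.fst - s.fst + (c.snd - s.snd)) := by
  obtain ⟨a, ha, hc | ⟨r, ⟨hr, h1, h2, h3⟩, hx, hy1, hy2⟩⟩ := h
  · obtain ⟨h1, h2, h3⟩ := mem_rayRight.1 hc
    obtain ⟨h4, h5⟩ := ha.upPath hR
    refine ⟨h4.trans h2, h1 ▸ (h5.horiz _ h3).cast ?_⟩
    rw [abs_of_nonneg (by linarith)]
    ring
  · obtain ⟨h4, h5⟩ := ha.upPath hR
    obtain ⟨-, h6, h7⟩ := mem_rayRight.1 h3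
    rw [hx]
    refine ⟨h4.trans h6, ((h5.horiz _ h7).up c.snd hy1 fun t ht => ?_).cast ?_⟩
    · rw [Set.uIcc_of_le hy1] at ht
      exact hR.free_left hr (h1.le.trans ht.1) (ht.2.trans hy2)
    · change a.fst ≤ r.x₁ at h6
      change _ + |r.x₁ - a.fst| + _ = r.x₁ - s.fst + (c.snd - s.snd)
      rw [abs_of_nonneg (by linarith)]
      ring

/-- The mirror image of a point under `x ↦ -x`. -/
def mirrorPt (p : Plane) : Plane := pt (-p.fst) p.snd

theorem mirrorPt_mirrorPt (p : Plane) : mirrorPt (mirrorPt p) = p := by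
  change pt (- -p.fst) p.snd = p
  rw [neg_neg]
  rfl

theorem rayRight.mirror {R : Finset Rect} {a c : Plane} (h : c ∈ rayRight R a) :
    mirrorPt c ∈ rayLeft (mirrorSet R) (mirrorPt a) := by
  obtain ⟨h1, h2, h3⟩ := mem_rayRight.1 h
  exact mem_rayLeft.2 ⟨h1, neg_le_neg h2, h3.mirror⟩

theorem rayLeft.mirror {R : Finset Rect} {a c : Plane} (h : c ∈ rayLeft R a) :
    mirrorPt c ∈ rayRight (mirrorSet R) (mirrorPt a) := by
  obtain ⟨h1, h2, h3⟩ := mem_rayLeft.1 h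
  exact mem_rayRight.2 ⟨h1, neg_le_neg h2, h3.mirror⟩

theorem HitsRight.mirror {R : Finset Rect} {a : Plane} {r : Rect} (h : HitsRight R a r) :
    HitsLeft (mirrorSet R) (mirrorPt a) r.mirror :=
  ⟨mirror_mem h.1, h.2.1, h.2.2.1, rayRight.mirror h.2.2.2⟩

theorem HitsLeft.mirror {R : Finset Rect} {a : Plane} {r : Rect} (h : HitsLeft R a r) :
    HitsRight (mirrorSet R) (mirrorPt a) r.mirror :=
  ⟨mirror_mem h.1, h.2.1, h.2.2.1, rayLeft.mirror h.2.2.2⟩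

theorem RUStart.mirror {R : Finset Rect} {s a : Plane} (h : RUStart R s a) :
    LUStart (mirrorSet R) (mirrorPt s) (mirrorPt a) := by
  induction h with
  | base => exact .base
  | step a r _ hr ih => exact .step _ _ ih hr.mirror

theorem LUStart.mirror {R : Finset Rect} {s a : Plane} (h : LUStart R s a) :
    RUStart (mirrorSet R) (mirrorPt s) (mirrorPt a) := by
  induction h with
  | base => exact .base
  | step a r _ hr ih => exact .step _ _ ih hr.mirror

theorem piRU.mirror {R : Finset Rect} {s c : Plane} (h : c ∈ piRU R s) :
    mirrorPt c ∈ piLU (mirrorSet R) (mirrorPt s) := by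
  obtain ⟨a, ha, hc | ⟨r, hr, hx, hy⟩⟩ := h
  · exact ⟨_, ha.mirror, .inl (rayRight.mirror hc)⟩
  · exact ⟨_, ha.mirror, .inr ⟨_, hr.mirror, congrArg Neg.neg hx, hy⟩⟩

theorem piLU.mirror {R : Finset Rect} {s c : Plane} (h : c ∈ piLU R s) :
    mirrorPt c ∈ piRU (mirrorSet R) (mirrorPt s) := by
  obtain ⟨a, ha, hc | ⟨r, hr, hx, hy⟩⟩ := h
  · exact ⟨_, ha.mirror, .inl (rayLeft.mirror hc)⟩
  · exact ⟨_, ha.mirror, .inr ⟨_, hr.mirror, congrArg Neg.neg hx, hy⟩⟩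

theorem mem_piLU_of_mirror {R : Finset Rect} {s c : Plane}
    (h : c ∈ piRU (mirrorSet R) (mirrorPt s)) : mirrorPt c ∈ piLU R s := by
  simpa [mirrorSet_mirrorSet, mirrorPt_mirrorPt] using piRU.mirror h

theorem YPlusReachable.mirror {R : Finset Rect} {s p : Plane} (h : YPlusReachable R s p) :
    YPlusReachable (mirrorSet R) (mirrorPt s) (mirrorPt p) := by
  obtain ⟨hp, c, hc, hx, hy⟩ := h
  exact ⟨pt_mem_freeSpace.2 (pt_mem_freeSpace.1 hp).mirror, mirrorPt c,
    hc.elim (fun h => .inr (piLU.mirror h)) (fun h => .inl (piRU.mirror h)),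
    congrArg Neg.neg hx, hy⟩

/-! ### Reachability along free segments -/

/-- Either the horizontal segment from `(x, y)` rightwards to `(v, y)` is free, or a rectangle stops
it. -/
theorem hFree_or_hitsRight {R : Finset Rect} {x y v : ℝ} (hf : Free R x y) (hv : x ≤ v) :
    HFree R y x v ∨ ∃ r, HitsRight R (pt x y) r ∧ r.x₁ < v := by
  classical
  let B := R.filter fun r => r.y₁ < y ∧ y < r.y₂ ∧ x ≤ r.x₁ ∧ r.x₁ < v
  have key : ∀ t, x ≤ t → t ≤ v → (∀ r ∈ B, t ≤ r.x₁) → Free R t y := by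
    rintro t h1 h2 hB r hr ⟨h3, h4, h5, h6⟩
    have hx : x ≤ r.x₁ := by
      by_contra! hlt
      exact hf r hr ⟨hlt, by linarith, h5, h6⟩
    have := hB r (Finset.mem_filter.2 ⟨hr, h5, h6, hx, by linarith⟩)
    linarith
  rcases B.eq_empty_or_nonempty with hB | hB
  · left
    intro t ht
    rw [Set.uIcc_of_le hv] at ht
    exact key t ht.1 ht.2 (by simp [hB])
  · right
    obtain ⟨r, hr, hmin⟩ := B.exists_min_image Rect.x₁ hB
    obtain ⟨h1, h2, h3, h4, h5⟩ := Finset.mem_filter.1 hr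
    refine ⟨r, ⟨h1, h2, h3, mem_rayRight.2 ⟨rfl, h4, fun t ht => ?_⟩⟩, h5⟩
    change t ∈ Set.uIcc x r.x₁ at ht
    rw [Set.uIcc_of_le h4] at ht
    exact key t ht.1 (ht.2.trans h5.le) fun r' hr' => ht.2.trans (hmin r' hr')

/-- The curve cannot climb over a free segment above it: a rectangle that stops the ray before `v`
cannot cut the segment at height `y`, so its top is at most `y` and the next ray still starts below.
Each climb lowers the number of rectangles whose top is above the current ray. -/
theorem exists_mem_piRU_of_start {R : Finset Rect} (hR : Nonoverlapping R) {s a : Plane}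
    {w v y : ℝ} (ha : RUStart R s a) (hw : a.fst ≤ w) (haw : HFree R a.snd a.fst w) (hwv : w ≤ v)
    (hy : a.snd ≤ y) (hf : HFree R y w v) : ∃ c ∈ piRU R s, c.fst = v ∧ c.snd ≤ y := by
  classical
  induction hn : (R.filter fun r => a.snd < r.y₂).card using Nat.strong_induction_on
    generalizing a w with
  | _ n ih =>
  rcases hFree_or_hitsRight (haw a.fst Set.left_mem_uIcc) (hw.trans hwv) with h | ⟨r, hr, hrv⟩
  · exact ⟨pt v a.snd, ⟨a, ha, .inl (mem_rayRight.2 ⟨rfl, hw.trans hwv, h⟩)⟩, rfl, hy⟩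
  · obtain ⟨hrR, h1, h2, h3⟩ := id hr
    change r.y₁ < a.snd at h1
    change a.snd < r.y₂ at h2
    have hwr : w ≤ r.x₁ := by
      by_contra! hlt
      have hle : r.x₁ < min w r.x₂ := lt_min hlt r.hx
      obtain ⟨t, ht1, ht2⟩ := exists_between hle
      obtain ⟨ht2, ht3⟩ := lt_min_iff.1 ht2
      have h4 : a.fst ≤ r.x₁ := (mem_rayRight.1 h3).2.1
      exact haw t (by rw [Set.uIcc_of_le hw]; exact ⟨by linarith, ht2.le⟩) r hrR ⟨ht1, ht3, h1, h2⟩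
    have hry : r.y₂ ≤ y := by
      by_contra! hlt
      obtain ⟨t, ht1, ht2⟩ := exists_between (lt_min hrv r.hx)
      obtain ⟨ht2, ht3⟩ := lt_min_iff.1 ht2
      exact hf t (by rw [Set.uIcc_of_le hwv]; exact ⟨by linarith, ht2.le⟩) r hrR
        ⟨ht1, ht3, by linarith, hlt⟩
    refine ih _ ?_ (ha.step a r hr) (le_refl r.x₁) ?_ hrv.le hry ?_ rfl
    · rw [← hn]
      refine Finset.card_lt_card (Finset.ssubset_iff_of_subset ?_ |>.2 ⟨r, ?_, ?_⟩)
      · intro r' hr'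
        rw [Finset.mem_filter] at hr' ⊢
        exact ⟨hr'.1, h2.trans hr'.2⟩
      · exact Finset.mem_filter.2 ⟨hrR, h2⟩
      · intro hr'
        exact lt_irrefl _ (Finset.mem_filter.1 hr').2
    · intro t ht
      change t ∈ Set.uIcc r.x₁ r.x₁ at ht
      rw [Set.uIcc_self, Set.mem_singleton_iff] at ht
      rw [ht]
      exact hR.free_top hrR le_rfl r.hx.le
    · exact hf.mono (by rw [Set.uIcc_of_le hwv]; exact ⟨hwr, hrv.le⟩) Set.right_mem_uIcc

theorem exists_mem_piRU_right {R : Finset Rect} (hR : Nonoverlapping R) {s c : Plane}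
    {v y : ℝ} (hc : c ∈ piRU R s) (hv : c.fst ≤ v) (hy : c.snd ≤ y) (hf : HFree R y c.fst v) :
    ∃ c' ∈ piRU R s, c'.fst = v ∧ c'.snd ≤ y := by
  obtain ⟨a, ha, h | ⟨r, hr, hx, hy1, hy2⟩⟩ := id hc
  · obtain ⟨h1, h2, h3⟩ := mem_rayRight.1 h
    exact exists_mem_piRU_of_start hR ha h2 h3 hv (h1 ▸ hy) hf
  · rcases hv.eq_or_lt with rfl | hlt
    · exact ⟨c, hc, rfl, hy⟩
    obtain ⟨hrR, h1, h2, h3⟩ := id hr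
    have hry : r.y₂ ≤ y := by
      by_contra! hlt'
      obtain ⟨t, ht1, ht2⟩ := exists_between (lt_min (hx ▸ hlt) r.hx)
      obtain ⟨ht2, ht3⟩ := lt_min_iff.1 ht2
      exact hf t (by rw [Set.uIcc_of_le hv]; exact ⟨by linarith, ht2.le⟩) r hrR
        ⟨ht1, ht3, by linarith, hlt'⟩
    refine exists_mem_piRU_of_start hR (ha.step a r hr) (le_refl r.x₁) ?_ (hx ▸ hv) hry (hx ▸ hf)
    intro t ht
    change t ∈ Set.uIcc r.x₁ r.x₁ at ht
    rw [Set.uIcc_self, Set.mem_singleton_iff] at ht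
    rw [ht]
    exact hR.free_top hrR le_rfl r.hx.le

theorem RUStart.exists_mem_piRU {R : Finset Rect} {s a : Plane} (hs : s ∈ freeSpace R)
    (ha : RUStart R s a) {x : ℝ} (h₁ : s.fst ≤ x) (h₂ : x ≤ a.fst) :
    ∃ c ∈ piRU R s, c.fst = x ∧ c.snd ≤ a.snd := by
  induction ha with
  | base =>
    refine ⟨s, ⟨s, .base, .inl (mem_rayRight.2 ⟨rfl, le_rfl, fun t ht => ?_⟩)⟩,
      le_antisymm h₁ h₂, le_rfl⟩
    rw [Set.uIcc_self, Set.mem_singleton_iff] at ht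
    exact ht ▸ pt_mem_freeSpace.1 hs
  | step a r ha hr ih =>
    have h4 : a.snd < r.y₂ := hr.2.2.1
    rcases le_total x a.fst with h | h
    · obtain ⟨c, hc, h2, h3⟩ := ih h
      exact ⟨c, hc, h2, h3.trans h4.le⟩
    · have h5 := (mem_rayRight.1 hr.2.2.2).2.2
      exact ⟨pt x a.snd, ⟨a, ha, .inl (mem_rayRight.2 ⟨rfl, h, h5.mono Set.left_mem_uIcc
        (Set.mem_uIcc.2 (.inl ⟨h, h₂⟩))⟩)⟩, rfl, h4.le⟩

theorem exists_mem_piRU_left {R : Finset Rect} {s c : Plane} (hs : s ∈ freeSpace R)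
    (hc : c ∈ piRU R s) {x : ℝ} (h₁ : s.fst ≤ x) (h₂ : x ≤ c.fst) :
    ∃ c' ∈ piRU R s, c'.fst = x ∧ c'.snd ≤ c.snd := by
  obtain ⟨a, ha, h⟩ := hc
  have key : a.snd ≤ c.snd ∧ ∃ w, c.fst = w ∧ HFree R a.snd a.fst w := by
    rcases h with h | ⟨r, hr, hx, hy1, hy2⟩
    · obtain ⟨h3, h4, h5⟩ := mem_rayRight.1 h
      exact ⟨h3.ge, _, rfl, h5⟩
    · exact ⟨hy1, _, hx, (mem_rayRight.1 hr.2.2.2).2.2⟩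
  obtain ⟨hy, w, rfl, hf⟩ := key
  rcases le_total x a.fst with hxa | hxa
  · obtain ⟨c', hc', h3, h4⟩ := ha.exists_mem_piRU hs h₁ hxa
    exact ⟨c', hc', h3, h4.trans hy⟩
  · exact ⟨pt x a.snd, ⟨a, ha, .inl (mem_rayRight.2 ⟨rfl, hxa, hf.mono Set.left_mem_uIcc
      (Set.mem_uIcc.2 (.inl ⟨hxa, h₂⟩))⟩)⟩, rfl, hy⟩

theorem self_mem_piRU {R : Finset Rect} {s : Plane} (hs : s ∈ freeSpace R) : s ∈ piRU R s := by
  refine ⟨s, .base, .inl (mem_rayRight.2 ⟨rfl, le_rfl, fun t ht => ?_⟩)⟩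
  rw [Set.uIcc_self, Set.mem_singleton_iff] at ht
  exact ht ▸ pt_mem_freeSpace.1 hs

theorem mirrorPt_mem_freeSpace {R : Finset Rect} {s : Plane} (hs : s ∈ freeSpace R) :
    mirrorPt s ∈ freeSpace (mirrorSet R) :=
  pt_mem_freeSpace.2 (pt_mem_freeSpace.1 hs).mirror

/-- If `v` is to the left of `s`, the segment passes over `s` itself, and the argument for the other
curve starts from there. -/
theorem exists_mem_of_mem_piRU {R : Finset Rect} (hR : Nonoverlapping R) {s c : Plane}
    (hs : s ∈ freeSpace R) (hc : c ∈ piRU R s) {y v : ℝ} (hy : c.snd ≤ y)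
    (hf : HFree R y c.fst v) : ∃ c' ∈ piLU R s ∪ piRU R s, c'.fst = v ∧ c'.snd ≤ y := by
  obtain ⟨hsc, hp⟩ := upPath_of_mem_piRU hR hc
  rcases le_total c.fst v with hv | hv
  · obtain ⟨c', h1, h2⟩ := exists_mem_piRU_right hR hc hv hy hf
    exact ⟨c', .inr h1, h2⟩
  rcases le_total s.fst v with hsv | hsv
  · obtain ⟨c', h1, h2, h3⟩ := exists_mem_piRU_left hs hc hsv hv
    exact ⟨c', .inr h1, h2, h3.trans hy⟩
  · have hf' := (hf.mono (Set.mem_uIcc.2 (.inr ⟨hsv, hsc⟩)) Set.right_mem_uIcc).mirror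
    obtain ⟨c', h1, h2, h3⟩ := exists_mem_piRU_right hR.mirror
      (self_mem_piRU (mirrorPt_mem_freeSpace hs)) (neg_le_neg hsv) (hp.le_snd.trans hy) hf'
    refine ⟨_, .inl (mem_piLU_of_mirror h1), ?_, h3⟩
    change -c'.fst = v
    rw [h2, neg_neg]

/-- Reachability is invariant along free horizontal segments. -/
theorem YPlusReachable.horiz {R : Finset Rect} (hR : Nonoverlapping R) {s : Plane} {x x' y : ℝ}
    (hs : s ∈ freeSpace R) (h : YPlusReachable R s (pt x y)) (hf : HFree R y x x') :
    YPlusReachable R s (pt x' y) := by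
  obtain ⟨-, c, hc, hx, hy⟩ := h
  refine ⟨pt_mem_freeSpace.2 (hf _ Set.right_mem_uIcc), ?_⟩
  change c.fst = x at hx
  change c.snd ≤ y at hy
  subst hx
  rcases hc with hc | hc
  · obtain ⟨c', h1, h2, h3⟩ := exists_mem_of_mem_piRU hR.mirror (mirrorPt_mem_freeSpace hs)
      (piLU.mirror hc) hy hf.mirror
    refine ⟨mirrorPt c', ?_, ?_, h3⟩
    · rcases h1 with h1 | h1
      · right
        simpa [mirrorSet_mirrorSet, mirrorPt_mirrorPt] using piLU.mirror h1
      · exact .inl (mem_piLU_of_mirror h1)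
    · change -c'.fst = x'
      rw [h2, neg_neg]
  · exact exists_mem_of_mem_piRU hR hs hc hy hf

theorem YPlusReachable.up {R : Finset Rect} {s : Plane} {x y y' : ℝ}
    (h : YPlusReachable R s (pt x y)) (hy : y ≤ y') (hf : Free R x y') :
    YPlusReachable R s (pt x y') := by
  obtain ⟨-, c, hc, h1, h2⟩ := h
  exact ⟨pt_mem_freeSpace.2 hf, c, hc, h1, h2.trans hy⟩

/-- A reachable point lies above a point that is joined to the site by a staircase. -/
theorem YPlusReachable.exists_upPath {R : Finset Rect} (hR : Nonoverlapping R) {s : Plane}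
    {x y : ℝ} (h : YPlusReachable R s (pt x y)) :
    ∃ v ≤ y, UpPath R s.fst s.snd x v (|x - s.fst| + (v - s.snd)) := by
  obtain ⟨-, c, hc, rfl, hy⟩ := h
  refine ⟨c.snd, hy, ?_⟩
  rcases hc with hc | hc
  · obtain ⟨h1, h2⟩ := upPath_of_mem_piRU hR.mirror (piLU.mirror hc)
    refine h2.of_mirror.cast ?_
    change -s.fst ≤ -c.fst at h1
    change -c.fst - -s.fst + (c.snd - s.snd) = |c.fst - s.fst| + (c.snd - s.snd)
    rw [abs_of_nonpos (by linarith)]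
    ring
  · obtain ⟨h1, h2⟩ := upPath_of_mem_piRU hR hc
    refine h2.cast ?_
    rw [abs_of_nonneg (by linarith)]

theorem YPlusReachable.self {R : Finset Rect} {s : Plane} (hs : s ∈ freeSpace R) :
    YPlusReachable R s s :=
  ⟨hs, s, .inr (self_mem_piRU hs), rfl, le_rfl⟩

/-! ### Descending staircases and horizontal shifts -/

/-- Either the vertical segment from `(x, z)` down to `(x, h)` is free, or the top side of a
rectangle stops it. -/
theorem vFree_or_exists_top {R : Finset Rect} {x h z : ℝ} (hz : Free R x z) (hh : h ≤ z) :
    VFree R x h z ∨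
      ∃ r ∈ R, r.x₁ < x ∧ x < r.x₂ ∧ h < r.y₂ ∧ r.y₂ ≤ z ∧ VFree R x r.y₂ z := by
  classical
  let B := R.filter fun r => r.x₁ < x ∧ x < r.x₂ ∧ h < r.y₂ ∧ r.y₂ ≤ z
  have key : ∀ t, h ≤ t → t ≤ z → (∀ r ∈ B, r.y₂ ≤ t) → Free R x t := by
    rintro t h1 h2 hB r hr ⟨h3, h4, h5, h6⟩
    have hy : r.y₂ ≤ z := by
      by_contra! hlt
      exact hz r hr ⟨h3, h4, by linarith, hlt⟩
    have := hB r (Finset.mem_filter.2 ⟨hr, h3, h4, by linarith, hy⟩)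
    linarith
  rcases B.eq_empty_or_nonempty with hB | hB
  · left
    intro t ht
    rw [Set.uIcc_of_le hh] at ht
    exact key t ht.1 ht.2 (by simp [hB])
  · right
    obtain ⟨r, hr, hmax⟩ := B.exists_max_image Rect.y₂ hB
    obtain ⟨h1, h2, h3, h4, h5⟩ := Finset.mem_filter.1 hr
    refine ⟨r, h1, h2, h3, h4, h5, fun t ht => ?_⟩
    rw [Set.uIcc_of_le h5] at ht
    exact key t (h4.le.trans ht.1) ht.2 fun r' hr' => (hmax r' hr').trans ht.1

/-- Going down and left from a free point by a staircase, one reaches a given vertical line or a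
given horizontal line. -/
theorem exists_staircase_below {R : Finset Rect} (hR : Nonoverlapping R) {x y x₀ h : ℝ}
    (hf : Free R x y) (hx : x₀ ≤ x) (hy : h ≤ y) :
    (∃ v, h ≤ v ∧ UpPath R x₀ v x y (x - x₀ + (y - v))) ∨
      ∃ w, x₀ ≤ w ∧ Free R w h ∧ UpPath R w h x y (x - w + (y - h)) := by
  classical
  -- Fall until a top side stops the descent, then follow it to its left corner; that rectangle is
  -- no longer strictly to the right of its left side, so it leaves the count.
  induction hn : (R.filter fun r => r.x₁ < x ∧ r.y₂ ≤ y).card using Nat.strong_induction_on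
    generalizing x y with
  | _ n ih =>
  rcases vFree_or_exists_top hf hy with hv | ⟨r, hr, h1, h2, h3, h4, hv⟩
  · exact .inr ⟨x, hx, hv _ Set.left_mem_uIcc, (UpPath.single_up hy hv).cast (by ring)⟩
  have hup := UpPath.single_up h4 hv
  have hleft : ∀ w, r.x₁ ≤ w → w ≤ x → UpPath R w r.y₂ x y (x - w + (y - r.y₂)) := by
    intro w h5 h6
    refine ((UpPath.single_horiz fun t ht => ?_).trans hup).cast
      (by rw [abs_of_nonneg (by linarith)])
    rw [Set.uIcc_of_le h6] at ht
    exact hR.free_top hr (h5.trans ht.1) (ht.2.trans h2.le)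
  rcases le_total r.x₁ x₀ with h5 | h5
  · exact .inl ⟨r.y₂, h3.le, hleft x₀ h5 hx⟩
  · have hp := hleft r.x₁ le_rfl h1.le
    have := ih _ ?_ (hR.free_top hr le_rfl r.hx.le) h5 h3.le rfl
    · rcases this with ⟨v, h6, h7⟩ | ⟨w, h6, hw, h7⟩
      · exact .inl ⟨v, h6, (h7.trans hp).cast (by ring)⟩
      · exact .inr ⟨w, h6, hw, (h7.trans hp).cast (by ring)⟩
    · rw [← hn]
      refine Finset.card_lt_card (Finset.ssubset_iff_of_subset ?_ |>.2 ⟨r, ?_, ?_⟩)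
      · intro r' hr'
        rw [Finset.mem_filter] at hr' ⊢
        exact ⟨hr'.1, hr'.2.1.trans h1, hr'.2.2.trans h4⟩
      · exact Finset.mem_filter.2 ⟨hr, h1, h4⟩
      · intro hr'
        exact lt_irrefl _ (Finset.mem_filter.1 hr').2.1

/-- A staircase going down and left from a free point to the right of the end of an upward path
meets that path, or passes to the right of its start. -/
theorem UpPath.exists_staircase {R : Finset Rect} (hR : Nonoverlapping R) {a b e y ℓ z : ℝ}
    (p : UpPath R a b e y ℓ) (hz : e ≤ z) (hf : Free R z y) :
    (∃ ℓ' ≤ ℓ + (z - e), UpPath R a b z y ℓ') ∨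
      ∃ w, a ≤ w ∧ UpPath R w b z y (z - w + (y - b)) := by
  -- The induction unwinds `p` from its end; `q` is the part of the staircase already descended,
  -- from the fixed point `(x, y')` to the current height.
  suffices ∀ x y', Free R z y → UpPath R z y x y' (x - z + (y' - y)) →
      (∃ ℓ' ≤ ℓ + (x - e) + (y' - y), UpPath R a b x y' ℓ') ∨
        ∃ w, a ≤ w ∧ UpPath R w b x y' (x - w + (y' - b)) by
    simpa using this z y hf (UpPath.refl.cast (by ring))
  clear hf
  intro x y' hf q
  induction p generalizing z with
  | refl => exact .inr ⟨z, hz, q⟩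
  | @horiz e y ℓ e' p hh ih =>
    rcases le_total e z with h | h
    · refine (ih h hf q).imp_left ?_
      rintro ⟨ℓ', h1, h2⟩
      exact ⟨ℓ', by linarith [le_abs_self (e' - e)], h2⟩
    · have hm : z ∈ Set.uIcc e e' := Set.mem_uIcc.2 (.inr ⟨hz, h⟩)
      refine .inl ⟨_, ?_, (p.horiz z (hh.mono Set.left_mem_uIcc hm)).trans q⟩
      have := abs_sub_add_abs_sub_of_mem_uIcc hm
      have := neg_abs_le (e' - z)
      linarith
  | @up e y ℓ y'' p hy hh ih =>
    rcases exists_staircase_below hR hf hz hy with ⟨v, h1, h2⟩ | ⟨w, h1, hw, h2⟩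
    · have hv : v ≤ y'' := h2.le_snd
      have hm : v ∈ Set.uIcc y y'' := Set.mem_uIcc.2 (.inl ⟨h1, hv⟩)
      exact .inl ⟨_, by linarith, ((p.up v h1 (hh.mono Set.left_mem_uIcc hm)).trans h2).trans q⟩
    · refine (ih h1 hw ((h2.trans q).cast (by ring))).imp_left ?_
      rintro ⟨ℓ', h3, h4⟩
      exact ⟨ℓ', by linarith, h4⟩

/-- Descend from `(g, y)` to the left. If the descent misses `p`, it passes to the right of the
start, so it crosses the staircase that reachability provides below `(g, y)`. Splicing the two at
the crossing gives a path as short as the L₁ distance of its ends. -/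
theorem UpPath.exists_shift_right {R : Finset Rect} (hR : Nonoverlapping R) {a b e y ℓ g : ℝ}
    (p : UpPath R a b e y ℓ) (hg : YPlusReachable R (pt a b) (pt g y)) (he : e ≤ g) :
    ∃ ℓ' ≤ ℓ + (g - e), UpPath R a b g y ℓ' := by
  rcases p.exists_staircase hR he (pt_mem_freeSpace.1 hg.1) with h | ⟨w, haw, q⟩
  · exact h
  obtain ⟨v, hv, c⟩ := hg.exists_upPath hR
  change UpPath R a b g v (|g - a| + (v - b)) at c
  obtain ⟨u, ℓ₁, ℓ₂, q₁, q₂, e₁⟩ := q.exists_snd_eq c.le_snd hv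
  -- The length of `q` is the L₁ distance of its ends, so `q` never goes beyond `g`.
  have hu : u ≤ g := by
    linarith [q₁.dist_le, q₂.dist_le, le_abs_self (u - w), le_abs_self (g - u), abs_nonneg (g - u)]
  obtain ⟨m, n, α₁, α₂, β₁, β₂, c₁, c₂, d₁, d₂, e₂, e₃⟩ := c.exists_common q₁ haw hu
  refine ⟨_, ?_, (c₁.trans d₂).trans q₂⟩
  linarith [p.dist_le, c₂.dist_le, d₁.dist_le, abs_sub_le g e a, abs_sub_le g m w,
    le_abs_self (g - w), abs_of_nonneg (sub_nonneg.2 he)]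

/-- A point at the height of the end of an upward path that is reachable from its start is joined to
its start by an upward path that is longer at most by the distance of the ends. -/
theorem UpPath.exists_shift {R : Finset Rect} (hR : Nonoverlapping R) {a b e y ℓ g : ℝ}
    (p : UpPath R a b e y ℓ) (hg : YPlusReachable R (pt a b) (pt g y)) :
    ∃ ℓ' ≤ ℓ + |g - e|, UpPath R a b g y ℓ' := by
  rcases le_total e g with h | h
  · rw [abs_of_nonneg (by linarith)]
    exact p.exists_shift_right hR hg h
  · obtain ⟨ℓ', h1, h2⟩ := p.mirror.exists_shift_right hR.mirror hg.mirror (neg_le_neg h)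
    refine ⟨ℓ', ?_, h2.of_mirror⟩
    change ℓ' ≤ ℓ + (-g - -e) at h1
    rw [abs_of_nonpos (by linarith)]
    linarith

theorem UpPath.reachable {R : Finset Rect} (hR : Nonoverlapping R) {a b x y ℓ : ℝ}
    (p : UpPath R a b x y ℓ) (hs : pt a b ∈ freeSpace R) :
    YPlusReachable R (pt a b) (pt x y) := by
  induction p with
  | refl => exact .self hs
  | horiz x' _ hf ih => exact ih.horiz hR hs hf
  | up y' _ hy hf ih => exact ih.up hy (hf _ Set.right_mem_uIcc)

/-! ### From free paths to upward paths -/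

/-- `FreePath R x₀ y₀ x y ℓ`: a free rectilinear path of length `ℓ` leads from `(x₀, y₀)` to
`(x, y)`. -/
inductive FreePath (R : Finset Rect) (x₀ y₀ : ℝ) : ℝ → ℝ → ℝ → Prop
  | refl : FreePath R x₀ y₀ x₀ y₀ 0
  | horiz {x y ℓ : ℝ} (x' : ℝ) : FreePath R x₀ y₀ x y ℓ → HFree R y x x' →
      FreePath R x₀ y₀ x' y (ℓ + |x' - x|)
  | vert {x y ℓ : ℝ} (y' : ℝ) : FreePath R x₀ y₀ x y ℓ → VFree R x y y' →
      FreePath R x₀ y₀ x y' (ℓ + |y' - y|)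

namespace FreePath

variable {R : Finset Rect}

theorem cast {a b x y ℓ ℓ' : ℝ} (h : FreePath R a b x y ℓ) (e : ℓ = ℓ') :
    FreePath R a b x y ℓ' :=
  e ▸ h

theorem trans {a b x y x' y' ℓ ℓ' : ℝ} (h : FreePath R a b x y ℓ)
    (h' : FreePath R x y x' y' ℓ') : FreePath R a b x' y' (ℓ + ℓ') := by
  induction h' with
  | refl => exact h.cast (by ring)
  | horiz x'' _ hf ih => exact (horiz x'' ih hf).cast (by ring)
  | vert y'' _ hf ih => exact (vert y'' ih hf).cast (by ring)

theorem symm {a b x y ℓ : ℝ} (h : FreePath R a b x y ℓ) : FreePath R x y a b ℓ := by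
  induction h with
  | refl => exact refl
  | @horiz x y ℓ x' _ hf ih =>
    exact ((refl.horiz x hf.symm).trans ih).cast (by rw [abs_sub_comm]; ring)
  | @vert x y ℓ y' _ hf ih =>
    exact ((refl.vert y hf.symm).trans ih).cast (by rw [abs_sub_comm]; ring)

theorem dist_le {a b x y ℓ : ℝ} (h : FreePath R a b x y ℓ) : |x - a| + |y - b| ≤ ℓ := by
  induction h with
  | refl => simp
  | @horiz x y ℓ x' _ _ ih => linarith [abs_sub_le x' x a]
  | @vert x y ℓ y' _ _ ih => linarith [abs_sub_le y' y b]

/-- A reachable point is joined to the start by an upward path no longer than a given path. -/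
theorem exists_upPath (hR : Nonoverlapping R) {a b x y ℓ : ℝ} (p : FreePath R a b x y ℓ)
    (hs : Free R a b) (h : YPlusReachable R (pt a b) (pt x y)) :
    ∃ ℓ' ≤ ℓ, UpPath R a b x y ℓ' := by
  have hs' := pt_mem_freeSpace.2 hs
  induction p with
  | refl => exact ⟨0, le_rfl, .refl⟩
  | @horiz x y ℓ x' p hf ih =>
    obtain ⟨ℓ', h1, h2⟩ := ih (h.horiz hR hs' hf.symm)
    exact ⟨_, by linarith, h2.horiz x' hf⟩
  | @vert x y ℓ y' p hf ih =>
    obtain ⟨v, hv, q⟩ := h.exists_upPath hR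
    change UpPath R a b x v (|x - a| + (v - b)) at q
    rcases le_total v y with hvy | hvy
    · have hxy : YPlusReachable R (pt a b) (pt x y) :=
        (q.reachable hR hs').up hvy (hf _ Set.left_mem_uIcc)
      obtain ⟨ℓ', h1, r⟩ := ih hxy
      rcases le_total y y' with hyy | hyy
      · exact ⟨_, by rw [abs_of_nonneg (by linarith)]; linarith, r.up y' hyy hf⟩
      -- A downward piece is undone by cutting the upward path at the lower height and shifting its
      -- end sideways; the discarded part is at least as long as the shift.
      · obtain ⟨w, ℓ₁, ℓ₂, r₁, r₂, e⟩ := r.exists_snd_eq (q.le_snd.trans hv) hyy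
        obtain ⟨ℓ'', h2, r₃⟩ := r₁.exists_shift hR h
        refine ⟨ℓ'', ?_, r₃⟩
        rw [abs_of_nonpos (by linarith)]
        linarith [r₂.dist_le]
    -- The last piece crosses the staircase from the start, and following the staircase up to there
    -- is optimal.
    · have hm : v ∈ Set.uIcc y y' := Set.mem_uIcc.2 (.inl ⟨hvy, hv⟩)
      refine ⟨_, ?_, q.up y' hv (hf.mono hm Set.right_mem_uIcc)⟩
      linarith [p.dist_le, le_abs_self (y - b), le_abs_self (y' - y)]

end FreePath

/-! ### The exchange argument -/

/-- An upward path that starts at the height of `s` to the left of `s` and ends at a point reachable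
from `s` meets a staircase from `s` to a point that is not to the right of `s`. -/
theorem UpPath.exists_staircase_left {R : Finset Rect} (hR : Nonoverlapping R) {a b e x y ℓ : ℝ}
    (hs : pt a b ∈ freeSpace R) (p : UpPath R e b x y ℓ) (he : e ≤ a)
    (h : YPlusReachable R (pt a b) (pt x y)) :
    ∃ w v ℓ₁ ℓ₂, w ≤ a ∧ UpPath R a b w v (a - w + (v - b)) ∧ UpPath R e b w v ℓ₁ ∧
      UpPath R w v x y ℓ₂ ∧ ℓ₁ + ℓ₂ = ℓ := by
  -- The invariant: until the path meets a staircase, its end is unreachable and not to the right of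
  -- `a`. It cannot cross the line over the site, where all free points above the site are
  -- reachable.
  suffices (∃ w v ℓ₁ ℓ₂, w ≤ a ∧ UpPath R a b w v (a - w + (v - b)) ∧ UpPath R e b w v ℓ₁ ∧
      UpPath R w v x y ℓ₂ ∧ ℓ₁ + ℓ₂ = ℓ) ∨ (¬ YPlusReachable R (pt a b) (pt x y) ∧ x ≤ a) from
    this.resolve_right fun h' => h'.1 h
  clear h
  induction p with
  | refl =>
    by_cases h : YPlusReachable R (pt a b) (pt e b)
    · obtain ⟨v, hv, q⟩ := h.exists_upPath hR
      change UpPath R a b e v (|e - a| + (v - b)) at q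
      obtain rfl : b = v := le_antisymm q.le_snd hv
      refine .inl ⟨e, b, 0, 0, he, q.cast ?_, .refl, .refl, by ring⟩
      rw [abs_of_nonpos (by linarith)]
      ring
    · exact .inr ⟨h, he⟩
  | @horiz x y ℓ x' p hf ih =>
    rcases ih with ⟨w, v, ℓ₁, ℓ₂, hw, q, p₁, p₂, e⟩ | ⟨h, hx⟩
    · exact .inl ⟨w, v, ℓ₁, _, hw, q, p₁, p₂.horiz x' hf, by linarith⟩
    · refine .inr ⟨fun h' => h (h'.horiz hR hs hf.symm), ?_⟩
      by_contra! hlt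
      have hm : a ∈ Set.uIcc x x' := Set.mem_uIcc.2 (.inl ⟨hx, hlt.le⟩)
      exact h (((YPlusReachable.self hs).up p.le_snd (hf a hm)).horiz hR hs
        (hf.mono hm Set.left_mem_uIcc))
  | @up x y ℓ y' p hy hf ih =>
    rcases ih with ⟨w, v, ℓ₁, ℓ₂, hw, q, p₁, p₂, e⟩ | ⟨h, hx⟩
    · exact .inl ⟨w, v, ℓ₁, _, hw, q, p₁, p₂.up y' hy hf, by linarith⟩
    · by_cases h' : YPlusReachable R (pt a b) (pt x y')
      · left
        obtain ⟨v, hv, q⟩ := h'.exists_upPath hR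
        change UpPath R a b x v (|x - a| + (v - b)) at q
        have hyv : y ≤ v := by
          by_contra! hlt
          exact h ((q.reachable hR hs).up hlt.le (hf _ Set.left_mem_uIcc))
        have hm : v ∈ Set.uIcc y y' := Set.mem_uIcc.2 (.inl ⟨hyv, hv⟩)
        refine ⟨x, v, _, _, hx, q.cast ?_, p.up v hyv (hf.mono Set.left_mem_uIcc hm),
          .single_up hv (hf.mono hm Set.right_mem_uIcc), by ring⟩
        rw [abs_of_nonpos (by linarith)]
        ring
      · exact .inr ⟨h', hx⟩

/-- The exchange argument when the left start is at least as high as the right one. -/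
theorem UpPath.exchange_of_le {R : Finset Rect} (hR : Nonoverlapping R) {a b a' b' u v y α β : ℝ}
    (hs : pt a b ∈ freeSpace R) (haa : a ≤ a') (hbb : b' ≤ b)
    (hu : YPlusReachable R (pt a b) (pt u y)) (huv : u ≤ v)
    (p : UpPath R a b v y α) (p' : UpPath R a' b' u y β) :
    (∃ α' β', UpPath R a b u y α' ∧ UpPath R a' b' v y β' ∧ α' + β' ≤ α + β) ∨
      ∃ α', UpPath R a b u y α' ∧ α' + (|a' - a| + |b' - b|) ≤ β := by
  obtain ⟨e, ℓ₁, ℓ₂, q₁, q₂, e₁⟩ := p'.exists_snd_eq hbb p.le_snd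
  rcases le_total a e with h | h
  · obtain ⟨w, z, m₁, m₂, n₁, n₂, r₁, r₂, t₁, t₂, e₂, e₃⟩ := p.exists_common q₂ h huv
    exact .inl ⟨_, _, r₁.trans t₂, (q₁.trans t₁).trans r₂, by linarith⟩
  -- The lower path reaches the meeting point only after passing the height `b` to the left of `a`;
  -- the staircase from `(a, b)` is shorter up to there by at least the L₁ distance of the starts.
  · obtain ⟨w, z, m₁, m₂, hw, r, t₁, t₂, e₂⟩ := q₂.exists_staircase_left hR hs h hu
    refine .inr ⟨_, r.trans t₂, ?_⟩
    rw [abs_of_nonneg (by linarith : 0 ≤ a' - a), abs_of_nonpos (by linarith : b' - b ≤ 0)]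
    linarith [(q₁.trans t₁).dist_le, neg_abs_le (w - a')]

/-- The exchange argument. -/
theorem UpPath.exchange {R : Finset Rect} (hR : Nonoverlapping R) {a b a' b' u v y α β : ℝ}
    (hs : pt a b ∈ freeSpace R) (hs' : pt a' b' ∈ freeSpace R) (haa : a ≤ a')
    (hu : YPlusReachable R (pt a b) (pt u y)) (hv : YPlusReachable R (pt a' b') (pt v y))
    (huv : u ≤ v) (p : UpPath R a b v y α) (p' : UpPath R a' b' u y β) :
    (∃ α' β', UpPath R a b u y α' ∧ UpPath R a' b' v y β' ∧ α' + β' ≤ α + β) ∨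
      (∃ α', UpPath R a b u y α' ∧ α' + (|a' - a| + |b' - b|) ≤ β) ∨
      ∃ β', UpPath R a' b' v y β' ∧ β' + (|a' - a| + |b' - b|) ≤ α := by
  rcases le_total b' b with h | h
  · exact (UpPath.exchange_of_le hR hs haa h hu huv p p').imp_right .inl
  -- Mirroring reverses left and right, hence swaps both the two starts and the two ends.
  · rcases UpPath.exchange_of_le hR.mirror (mirrorPt_mem_freeSpace hs') (neg_le_neg haa) h
      hv.mirror (neg_le_neg huv) p'.mirror p.mirror with ⟨β', α', h1, h2, h3⟩ | ⟨β', h1, h2⟩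
    · exact .inl ⟨α', β', h2.of_mirror, h1.of_mirror, by linarith⟩
    · refine .inr (.inr ⟨β', h1.of_mirror, ?_⟩)
      rwa [abs_sub_comm b', show a' - a = -a - -a' by ring]

/-! ### From continuous paths to rectilinear ones -/

/-- `δ` is less than every width of a rectangle and every positive difference of heights of
horizontal sides. -/
def Separates (R : Finset Rect) (δ : ℝ) : Prop :=
  (∀ r ∈ R, δ < r.x₂ - r.x₁) ∧ ∀ c, ∀ r ∈ R, (c = r.y₁ ∨ c = r.y₂) → ∀ c', ∀ r' ∈ R,
    (c' = r'.y₁ ∨ c' = r'.y₂) → |c' - c| < δ → c = c'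

theorem exists_separates (R : Finset Rect) : ∃ δ > 0, Separates R δ := by
  have key : ∀ f : Rect × Rect → ℝ, ∀ᶠ δ in nhdsWithin (0 : ℝ) (Set.Ioi 0),
      ∀ i ∈ R ×ˢ R, 0 < f i → δ < f i := by
    intro f
    rw [Filter.eventually_all_finset]
    intro i _
    by_cases h : 0 < f i
    · filter_upwards [mem_nhdsWithin_of_mem_nhds (Iio_mem_nhds h)] with δ hδ _ using hδ
    · exact Filter.Eventually.of_forall fun δ h' => absurd h' h
  obtain ⟨δ, hδ, h0, h1, h2, h3⟩ := ((eventually_mem_nhdsWithin (a := (0 : ℝ)) (s := Set.Ioi 0)).and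
    ((key fun i => i.1.x₂ - i.1.x₁).and ((key fun i => |i.1.y₁ - i.2.y₁|).and
    ((key fun i => |i.1.y₂ - i.2.y₂|).and ((key fun i => |i.1.y₁ - i.2.y₂|)))))).exists
  refine ⟨δ, hδ, fun r hr => h0 (r, r) (Finset.mk_mem_product hr hr) (sub_pos.2 r.hx), ?_⟩
  rintro c r hr hc c' r' hr' hc' hlt
  by_contra hne
  have h12 := Finset.mk_mem_product hr hr'
  have h21 := Finset.mk_mem_product hr' hr
  have hpos : 0 < |c' - c| := abs_pos.2 (sub_ne_zero.2 (Ne.symm hne))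
  rcases hc with rfl | rfl <;> rcases hc' with rfl | rfl
  · exact hlt.not_gt (h1 _ h21 hpos)
  · rw [abs_sub_comm] at hlt hpos
    exact hlt.not_gt (h3 _ h12 hpos)
  · exact hlt.not_gt (h3 _ h21 hpos)
  · exact hlt.not_gt (h2 _ h21 hpos)

/-- Close free points are joined by a free path as long as their `L₁` distance. -/
theorem Separates.freePath_of_le {R : Finset Rect} {δ : ℝ} (hδ : Separates R δ) {x y x' y' : ℝ}
    (hf : Free R x y) (hf' : Free R x' y') (hx : |x' - x| < δ) (hy : |y' - y| < δ) (hyy : y ≤ y') :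
    FreePath R x y x' y' (|x' - x| + |y' - y|) := by
  -- At most one level of horizontal sides lies between `y` and `y'`. Making the horizontal move at
  -- that level keeps it out of every rectangle that begins or ends there.
  obtain ⟨Y, hY₁, hY₂, hY⟩ : ∃ Y, y ≤ Y ∧ Y ≤ y' ∧ ∀ c, ∀ r ∈ R, (c = r.y₁ ∨ c = r.y₂) →
      y ≤ c → c ≤ y' → c = Y := by
    by_cases h : ∃ c, (∃ r ∈ R, c = r.y₁ ∨ c = r.y₂) ∧ y ≤ c ∧ c ≤ y'
    · obtain ⟨Y, ⟨r, hr, hrY⟩, h1, h2⟩ := h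
      refine ⟨Y, h1, h2, fun c r' hr' hc h3 h4 => hδ.2 c r' hr' hc Y r hr hrY ?_⟩
      rw [abs_of_nonneg (by linarith : 0 ≤ y' - y)] at hy
      rw [abs_lt]
      constructor <;> linarith
    · exact ⟨y, le_rfl, hyy, fun c r hr hc h1 h2 => absurd ⟨c, ⟨r, hr, hc⟩, h1, h2⟩ h⟩
  have hm : Y ∈ Set.uIcc y y' := Set.mem_uIcc.2 (.inl ⟨hY₁, hY₂⟩)
  have v₁ : VFree R x y Y := by
    rintro t ht r hr ⟨h1, h2, h3, h4⟩
    rw [Set.uIcc_of_le hY₁] at ht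
    have h5 : y ≤ r.y₁ := by
      by_contra! h
      exact hf r hr ⟨h1, h2, h, by linarith [ht.1]⟩
    have := hY _ r hr (.inl rfl) h5 (by linarith [ht.2])
    linarith [ht.2]
  have v₂ : VFree R x' Y y' := by
    rintro t ht r hr ⟨h1, h2, h3, h4⟩
    rw [Set.uIcc_of_le hY₂] at ht
    have h5 : r.y₂ ≤ y' := by
      by_contra! h
      exact hf' r hr ⟨h1, h2, by linarith [ht.2], h⟩
    have := hY _ r hr (.inr rfl) (by linarith [ht.1]) h5
    linarith [ht.1]
  -- A rectangle cutting this piece spans all heights from `y` to `y'` and is wider than `δ`, so it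
  -- would contain one of the two end points.
  have hh : HFree R Y x x' := by
    rintro t ht r hr ⟨h1, h2, h3, h4⟩
    have h5 : r.y₁ < y := by
      by_contra! h
      exact h3.ne (hY _ r hr (.inl rfl) h (by linarith))
    have h6 : y' < r.y₂ := by
      by_contra! h
      exact h4.ne' (hY _ r hr (.inr rfl) (by linarith) h)
    have h7 := hδ.1 r hr
    rw [abs_lt] at hx
    rcases Set.mem_uIcc.1 ht with ⟨h8, h9⟩ | ⟨h8, h9⟩
    · have : x ≤ r.x₁ := by
        by_contra! h
        exact hf r hr ⟨h, by linarith, h5, by linarith⟩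
      exact hf' r hr ⟨by linarith, by linarith, by linarith, h6⟩
    · have : x' ≤ r.x₁ := by
        by_contra! h
        exact hf' r hr ⟨h, by linarith, by linarith, h6⟩
      exact hf r hr ⟨by linarith, by linarith, h5, by linarith⟩
  refine (((FreePath.refl.vert Y v₁).horiz x' hh).vert y' v₂).cast ?_
  linarith [abs_sub_add_abs_sub_of_mem_uIcc hm]

theorem Separates.freePath {R : Finset Rect} {δ : ℝ} (hδ : Separates R δ) {x y x' y' : ℝ}
    (hf : Free R x y) (hf' : Free R x' y') (hx : |x' - x| < δ) (hy : |y' - y| < δ) :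
    FreePath R x y x' y' (|x' - x| + |y' - y|) := by
  rcases le_total y y' with h | h
  · exact hδ.freePath_of_le hf hf' hx hy h
  · rw [abs_sub_comm x' x, abs_sub_comm y' y] at *
    exact (hδ.freePath_of_le hf' hf hx hy h).symm

theorem dist_eq (p q : Plane) : dist p q = |p.fst - q.fst| + |p.snd - q.snd| :=
  WithLp.prod_dist_eq_of_L1 p q

/-- A continuous free path of finite length can be replaced by a rectilinear one that is not
longer. -/
theorem exists_freePath {R : Finset Rect} {p q : Plane} (γ : Path p q)
    (hγ : Set.range γ ⊆ freeSpace R) :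
    ∃ ℓ, FreePath R p.fst p.snd q.fst q.snd ℓ ∧ ENNReal.ofReal ℓ ≤ eVariationOn γ Set.univ := by
  obtain ⟨δ, hδ0, hδ⟩ := exists_separates R
  obtain ⟨η, hη0, hη⟩ := Metric.uniformContinuous_iff.1
    (CompactSpace.uniformContinuous_of_continuous γ.continuous) δ hδ0
  obtain ⟨N, hN⟩ := exists_nat_one_div_lt hη0
  -- The subdivision points i/(N+1), clamped to the unit interval. Steps shorter than `δ` become
  -- free paths of the same L₁ length, and the sum of these is bounded by the variation.
  let u : ℕ → unitInterval := fun i => Set.projIcc 0 1 zero_le_one ((i : ℝ) * (1 / ((N : ℝ) + 1)))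
  have hpos : (0 : ℝ) < 1 / ((N : ℝ) + 1) := by positivity
  have hu : Monotone u := by
    intro i j hij
    exact Set.monotone_projIcc _ (mul_le_mul_of_nonneg_right (Nat.cast_le.2 hij) hpos.le)
  have hstep : ∀ i, dist (γ (u (i + 1))) (γ (u i)) < δ := by
    intro i
    refine hη (lt_of_le_of_lt ((LipschitzWith.projIcc zero_le_one).dist_le_mul _ _) ?_)
    rw [Real.dist_eq, ← sub_mul]
    push_cast
    rw [add_sub_cancel_left, one_mul, one_mul, abs_of_pos hpos]
    exact hN
  have hfree : ∀ t, Free R (γ t).fst (γ t).snd := fun t => pt_mem_freeSpace.1 (hγ ⟨t, rfl⟩)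
  have hu0 : γ (u 0) = p := by
    have : u 0 = 0 := by simp [u]
    rw [this, γ.source]
  have huN : γ (u (N + 1)) = q := by
    have : u (N + 1) = 1 := by
      have h : ((N : ℝ) + 1) * (1 / ((N : ℝ) + 1)) = 1 := by field_simp
      simp only [u]
      push_cast
      rw [h, Set.projIcc_right]
      rfl
    rw [this, γ.target]
  have key : ∀ n, FreePath R p.fst p.snd (γ (u n)).fst (γ (u n)).snd
      (∑ i ∈ Finset.range n, dist (γ (u (i + 1))) (γ (u i))) := by
    intro n
    induction n with
    | zero => rw [hu0]; exact FreePath.refl.cast (by simp)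
    | succ n ih =>
      rw [Finset.sum_range_succ]
      have h := hstep n
      rw [dist_eq] at h
      refine (ih.trans (hδ.freePath (hfree _) (hfree _) ?_ ?_)).cast (by rw [dist_eq (γ (u (n + 1)))])
      · linarith [abs_nonneg ((γ (u (n + 1))).snd - (γ (u n)).snd)]
      · linarith [abs_nonneg ((γ (u (n + 1))).fst - (γ (u n)).fst)]
  refine ⟨_, huN ▸ key (N + 1), ?_⟩
  rw [ENNReal.ofReal_sum_of_nonneg fun _ _ => dist_nonneg]
  simp_rw [← edist_dist]
  exact eVariationOn.sum_le hu fun _ => Set.mem_univ _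

theorem exists_upPath_of_geodesicDist_lt {R : Finset Rect} (hR : Nonoverlapping R) {s p : Plane}
    (hs : s ∈ freeSpace R) (h : YPlusReachable R s p) {c : ENNReal} (hc : geodesicDist R s p < c) :
    ∃ ℓ, UpPath R s.fst s.snd p.fst p.snd ℓ ∧ ENNReal.ofReal ℓ < c := by
  simp only [geodesicDist, iInf_lt_iff] at hc
  obtain ⟨γ, hγ, hlt⟩ := hc
  obtain ⟨ℓ, h1, h2⟩ := exists_freePath γ hγ
  obtain ⟨ℓ', h3, h4⟩ := h1.exists_upPath hR (pt_mem_freeSpace.1 hs) h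
  exact ⟨ℓ', h4, (ENNReal.ofReal_le_ofReal h3).trans_lt (h2.trans_lt hlt)⟩

/-! ### The geodesic distance and lengths of upward paths -/

theorem eVariationOn_segment_le (a b : Plane) :
    eVariationOn (Path.segment a b) Set.univ ≤ edist a b := by
  have hL : LipschitzWith (nndist a b) (AffineMap.lineMap a b : ℝ → Plane) :=
    LipschitzWith.of_dist_le_mul fun s t => by
      rw [dist_lineMap_lineMap, mul_comm, coe_nndist]
  have h1 : eVariationOn (Subtype.val : unitInterval → ℝ) Set.univ ≤ 1 := by
    have hm : MonotoneOn (Subtype.val : unitInterval → ℝ) Set.univ := fun _ _ _ _ h => h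
    have := hm.eVariationOn_eq (Set.mem_univ (0 : unitInterval)) (Set.mem_univ (1 : unitInterval))
    rw [show Set.univ ∩ Set.Icc (0 : unitInterval) 1 = Set.univ from
      Set.eq_univ_of_forall fun t => ⟨Set.mem_univ t, t.2.1, t.2.2⟩] at this
    simp [this]
  have h2 := (hL.lipschitzOnWith (s := Set.univ)).comp_eVariationOn_le
    (g := (Subtype.val : unitInterval → ℝ)) (s := Set.univ) (Set.mapsTo_univ _ _)
  calc eVariationOn (Path.segment a b) Set.univ
      ≤ nndist a b * eVariationOn (Subtype.val : unitInterval → ℝ) Set.univ := h2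
    _ ≤ nndist a b * 1 := by gcongr
    _ = edist a b := by rw [mul_one, edist_nndist]

theorem geodesicDist_le_edist {R : Finset Rect} {a b : Plane} (h : segment ℝ a b ⊆ freeSpace R) :
    geodesicDist R a b ≤ edist a b :=
  iInf₂_le_of_le (Path.segment a b) (by rwa [Path.range_segment]) (eVariationOn_segment_le a b)

/-- Each half of the concatenation is a monotone reparametrization of one path, and variation is
additive at the midpoint. -/
theorem eVariationOn_trans_le {a b c : Plane} (γ : Path a b) (γ' : Path b c) :
    eVariationOn (γ.trans γ') Set.univ ≤ eVariationOn γ Set.univ + eVariationOn γ' Set.univ := by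
  let m : unitInterval := ⟨1 / 2, by norm_num, by norm_num⟩
  have hm := eVariationOn.union (γ.trans γ') (isGreatest_Iic (a := m)) isLeast_Ici
  rw [Set.Iic_union_Ici] at hm
  rw [hm]
  refine add_le_add ?_ ?_
  · let φ : unitInterval → unitInterval := fun t => Set.projIcc 0 1 zero_le_one (2 * (t : ℝ))
    have hφ : MonotoneOn φ (Set.Iic m) := fun s _ t _ h =>
      Set.monotone_projIcc _ (mul_le_mul_of_nonneg_left (Subtype.coe_le_coe.2 h) zero_le_two)
    refine le_trans (eVariationOn.congr fun t ht => ?_).le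
      (eVariationOn.comp_le_of_monotoneOn γ φ hφ (Set.mapsTo_univ _ _))
    have ht' : (t : ℝ) ≤ 1 / 2 := ht
    have h0 := t.2.1
    rw [Path.trans_apply, dif_pos ht']
    simp only [Function.comp, φ]
    rw [Set.projIcc_of_mem]
  · let φ : unitInterval → unitInterval := fun t => Set.projIcc 0 1 zero_le_one (2 * (t : ℝ) - 1)
    have hφ : MonotoneOn φ (Set.Ici m) := fun s _ t _ h =>
      Set.monotone_projIcc _ (sub_le_sub_right
        (mul_le_mul_of_nonneg_left (Subtype.coe_le_coe.2 h) zero_le_two) 1)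
    refine le_trans (eVariationOn.congr fun t ht => ?_).le
      (eVariationOn.comp_le_of_monotoneOn γ' φ hφ (Set.mapsTo_univ _ _))
    have ht' : 1 / 2 ≤ (t : ℝ) := ht
    have h0 := t.2.2
    rw [Path.trans_apply]
    simp only [Function.comp, φ]
    split_ifs with h
    · have : (t : ℝ) = 1 / 2 := le_antisymm h ht'
      simp [this]
    · rw [Set.projIcc_of_mem]

theorem geodesicDist_triangle {R : Finset Rect} (a b c : Plane) :
    geodesicDist R a c ≤ geodesicDist R a b + geodesicDist R b c := by
  simp only [geodesicDist, ENNReal.iInf_add, ENNReal.add_iInf, le_iInf_iff]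
  intro γ' hγ' γ hγ
  refine iInf₂_le_of_le (γ.trans γ') ?_ (eVariationOn_trans_le γ γ')
  rw [Path.trans_range]
  exact Set.union_subset hγ hγ'

theorem geodesicDist_comm {R : Finset Rect} (a b : Plane) :
    geodesicDist R a b = geodesicDist R b a := by
  suffices ∀ a b, geodesicDist R a b ≤ geodesicDist R b a from le_antisymm (this a b) (this b a)
  intro a b
  refine le_iInf₂ fun γ hγ => iInf₂_le_of_le γ.symm (by rwa [Path.symm_range]) ?_
  exact eVariationOn.comp_le_of_antitoneOn γ unitInterval.symm
    (fun _ _ _ _ h => unitInterval.symm_le_symm.2 h) (Set.mapsTo_univ _ _)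

theorem segment_horiz {x x' y : ℝ} :
    segment ℝ (pt x y) (pt x' y) = {c | c.snd = y ∧ c.fst ∈ Set.uIcc x x'} := by
  ext c
  rw [Set.mem_ofPred_eq, ← segment_eq_uIcc]
  constructor
  · rintro ⟨a, b, ha, hb, hab, rfl⟩
    refine ⟨?_, a, b, ha, hb, hab, rfl⟩
    change a * y + b * y = y
    rw [← add_mul, hab, one_mul]
  · rintro ⟨h1, a, b, ha, hb, hab, h2⟩
    refine ⟨a, b, ha, hb, hab, ?_⟩
    change pt (a * x + b * x') (a * y + b * y) = pt c.fst c.snd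
    rw [← add_mul, hab, one_mul, h1, ← h2]
    rfl

theorem segment_vert {x y y' : ℝ} :
    segment ℝ (pt x y) (pt x y') = {c | c.fst = x ∧ c.snd ∈ Set.uIcc y y'} := by
  ext c
  rw [Set.mem_ofPred_eq, ← segment_eq_uIcc]
  constructor
  · rintro ⟨a, b, ha, hb, hab, rfl⟩
    refine ⟨?_, a, b, ha, hb, hab, rfl⟩
    change a * x + b * x = x
    rw [← add_mul, hab, one_mul]
  · rintro ⟨h1, a, b, ha, hb, hab, h2⟩
    refine ⟨a, b, ha, hb, hab, ?_⟩
    change pt (a * x + b * x) (a * y + b * y') = pt c.fst c.snd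
    rw [← add_mul, hab, one_mul, h1, ← h2]
    rfl

theorem HFree.geodesicDist_le {R : Finset Rect} {x x' y : ℝ} (h : HFree R y x x') :
    geodesicDist R (pt x y) (pt x' y) ≤ ENNReal.ofReal |x' - x| := by
  refine (geodesicDist_le_edist ?_).trans_eq ?_
  · rw [segment_horiz]
    rintro c ⟨rfl, h2⟩
    exact pt_mem_freeSpace.2 (h _ h2)
  · rw [edist_dist, dist_eq]
    change ENNReal.ofReal (|x - x'| + |y - y|) = _
    rw [sub_self, abs_zero, add_zero, abs_sub_comm]

theorem VFree.geodesicDist_le {R : Finset Rect} {x y y' : ℝ} (h : VFree R x y y') :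
    geodesicDist R (pt x y) (pt x y') ≤ ENNReal.ofReal |y' - y| := by
  refine (geodesicDist_le_edist ?_).trans_eq ?_
  · rw [segment_vert]
    rintro c ⟨rfl, h2⟩
    exact pt_mem_freeSpace.2 (h _ h2)
  · rw [edist_dist, dist_eq]
    change ENNReal.ofReal (|x - x| + |y - y'|) = _
    rw [sub_self, abs_zero, zero_add, abs_sub_comm]

theorem UpPath.geodesicDist_le {R : Finset Rect} {a b x y ℓ : ℝ} (hs : Free R a b)
    (h : UpPath R a b x y ℓ) : geodesicDist R (pt a b) (pt x y) ≤ ENNReal.ofReal ℓ := by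
  induction h with
  | refl =>
    have : HFree R b a a := fun t ht => by
      rw [Set.uIcc_self, Set.mem_singleton_iff] at ht
      exact ht ▸ hs
    simpa using this.geodesicDist_le
  | @horiz x y ℓ x' p hf ih =>
    have h0 : 0 ≤ ℓ := by linarith [p.dist_le, p.le_snd, abs_nonneg (x - a)]
    rw [ENNReal.ofReal_add h0 (abs_nonneg _)]
    exact (geodesicDist_triangle _ _ _).trans (add_le_add ih hf.geodesicDist_le)
  | @up x y ℓ y' p hy hf ih =>
    have h0 : 0 ≤ ℓ := by linarith [p.dist_le, p.le_snd, abs_nonneg (x - a)]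
    rw [ENNReal.ofReal_add h0 (sub_nonneg.2 hy)]
    refine (geodesicDist_triangle _ _ _).trans (add_le_add ih ?_)
    simpa [abs_of_nonneg (sub_nonneg.2 hy)] using hf.geodesicDist_le

theorem exists_upPath_lt {R : Finset Rect} (hR : Nonoverlapping R) {s p : Plane}
    (hs : s ∈ freeSpace R) (h : YPlusReachable R s p) (hfin : geodesicDist R s p ≠ ⊤) {ε : ℝ}
    (hε : 0 < ε) :
    ∃ ℓ, UpPath R s.fst s.snd p.fst p.snd ℓ ∧ ℓ < (geodesicDist R s p).toReal + ε := by
  have hpos : 0 < (geodesicDist R s p).toReal + ε := by positivity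
  obtain ⟨ℓ, h1, h2⟩ := exists_upPath_of_geodesicDist_lt hR hs h
    (c := ENNReal.ofReal ((geodesicDist R s p).toReal + ε))
    ((ENNReal.lt_ofReal_iff_toReal_lt hfin).2 (by linarith))
  exact ⟨ℓ, h1, (ENNReal.ofReal_lt_ofReal_iff hpos).1 h2⟩

theorem UpPath.toReal_le {R : Finset Rect} {s p : Plane} {ℓ : ℝ} (hs : s ∈ freeSpace R)
    (h : UpPath R s.fst s.snd p.fst p.snd ℓ) : (geodesicDist R s p).toReal ≤ ℓ := by
  have h0 : 0 ≤ ℓ := by linarith [h.dist_le, h.le_snd, abs_nonneg (p.fst - s.fst)]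
  exact ENNReal.toReal_le_of_le_ofReal h0 (h.geodesicDist_le (pt_mem_freeSpace.1 hs))

theorem geodesicDist_ne_top_of_hFree {R : Finset Rect} {s : Plane} {u v y : ℝ}
    (h : HFree R y u v) (hu : geodesicDist R s (pt u y) ≠ ⊤) : geodesicDist R s (pt v y) ≠ ⊤ :=
  ne_top_of_le_ne_top (ENNReal.add_ne_top.2
    ⟨hu, ne_top_of_le_ne_top ENNReal.ofReal_ne_top h.geodesicDist_le⟩)
    (geodesicDist_triangle s (pt u y) (pt v y))

/-! ### Order of the sites -/

/-- On a free horizontal segment the site that is farther from the left end lies to the right. -/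
theorem fst_lt_of_farther {R : Finset Rect} (hR : Nonoverlapping R) {s s' : Plane} {u v y : ℝ}
    (hs : s ∈ freeSpace R) (hs' : s' ∈ freeSpace R) (hne : s ≠ s') (huv : u ≤ v)
    (hf : HFree R y u v) (hu : YPlusReachable R s (pt u y)) (hu' : YPlusReachable R s' (pt u y))
    (h₁ : geodesicDist R s' (pt u y) ≤ geodesicDist R s (pt u y))
    (h₂ : geodesicDist R s (pt v y) ≤ geodesicDist R s' (pt v y))
    (hlt : geodesicDist R s' (pt u y) < geodesicDist R s (pt u y) ∨
      geodesicDist R s (pt v y) < geodesicDist R s' (pt v y)) : s'.fst < s.fst := by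
  by_contra! hle
  have hv := hu.horiz hR hs hf
  have hv' := hu'.horiz hR hs' hf
  -- The strict inequality makes one distance finite, and the free segment and the other inequality
  -- carry finiteness over to the rest.
  have hfin : geodesicDist R s (pt u y) ≠ ⊤ ∧ geodesicDist R s' (pt v y) ≠ ⊤ := by
    rcases hlt with hlt | hlt
    · have h := geodesicDist_ne_top_of_hFree hf hlt.ne_top
      exact ⟨geodesicDist_ne_top_of_hFree hf.symm (ne_top_of_le_ne_top h h₂), h⟩
    · have h := geodesicDist_ne_top_of_hFree hf.symm hlt.ne_top
      exact ⟨h, geodesicDist_ne_top_of_hFree hf (ne_top_of_le_ne_top h h₁)⟩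
  have hfin₁ := ne_top_of_le_ne_top hfin.1 h₁
  have hfin₂ := ne_top_of_le_ne_top hfin.2 h₂
  have e₁ := ENNReal.toReal_mono hfin.1 h₁
  have e₂ := ENNReal.toReal_mono hfin.2 h₂
  have hsum : (geodesicDist R s' (pt u y)).toReal + (geodesicDist R s (pt v y)).toReal <
      (geodesicDist R s (pt u y)).toReal + (geodesicDist R s' (pt v y)).toReal := by
    rcases hlt with hlt | hlt
    · linarith [(ENNReal.toReal_lt_toReal hfin₁ hfin.1).2 hlt]
    · linarith [(ENNReal.toReal_lt_toReal hfin₂ hfin.2).2 hlt]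
  have hd : 0 < |s'.fst - s.fst| + |s'.snd - s.snd| := by
    rw [← dist_eq]
    exact dist_pos.2 hne.symm
  -- Half the gap rules out the crossing case, where two errors add up; the L₁ distance of the sites
  -- rules out the other two cases.
  obtain ⟨ε, hε, hε'⟩ := exists_between (lt_min hd (half_pos (sub_pos.2 hsum)))
  obtain ⟨hε₁, hε₂⟩ := lt_min_iff.1 hε'
  obtain ⟨α, p, hα⟩ := exists_upPath_lt hR hs hv hfin₂ hε
  obtain ⟨β, p', hβ⟩ := exists_upPath_lt hR hs' hu' hfin₁ hε
  rcases UpPath.exchange (a := s.fst) (b := s.snd) (a' := s'.fst) (b' := s'.snd)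
      hR hs hs' hle hu hv' huv p p' with
    ⟨α', β', q, q', h⟩ | ⟨α', q, h⟩ | ⟨β', q', h⟩
  · have := q.toReal_le (p := pt u y) hs
    have := q'.toReal_le (p := pt v y) hs'
    linarith
  · have := q.toReal_le (p := pt u y) hs
    linarith
  · have := q'.toReal_le (p := pt v y) hs'
    linarith

end RectFVD

theorem mainTheorem4 (R : Finset RectFVD.Rect)
    (hR : (R : Set RectFVD.Rect).PairwiseDisjoint RectFVD.Rect.openSet)
    (S : Finset RectFVD.Plane) (hS : ∀ s ∈ S, s ∈ RectFVD.freeSpace R)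
    (p q : RectFVD.Plane) (hy : p.snd = q.snd) (hx : p.fst < q.fst)
    (hpq : segment ℝ p q ⊆ RectFVD.freeSpace R) :
    (∀ fp ∈ RectFVD.farthestSites R S p, ∀ fq ∈ RectFVD.farthestSites R S q,
      RectFVD.YPlusReachable R fp p → RectFVD.YPlusReachable R fp q →
      RectFVD.YPlusReachable R fq p → RectFVD.YPlusReachable R fq q →
      (fp ∉ RectFVD.farthestSites R S q ∨ fq ∉ RectFVD.farthestSites R S p) →
      fp.fst > fq.fst) ∧
    (∀ a ∈ segment ℝ p q, ∀ b ∈ segment ℝ p q, a.fst < b.fst →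
      ∀ s s' : RectFVD.Plane, s ≠ s' →
      a ∈ RectFVD.yPlusCell R S s → b ∈ RectFVD.yPlusCell R S s' →
      s.fst > s'.fst) := by
  have hR' := RectFVD.nonoverlapping_of_pairwiseDisjoint hR
  have hpq' : segment ℝ p q = {c | c.snd = p.snd ∧ c.fst ∈ Set.uIcc p.fst q.fst} := by
    rw [← RectFVD.segment_horiz]
    congr 1
    change RectFVD.pt q.fst q.snd = _
    rw [hy]
  rw [hpq'] at hpq ⊢
  have hf : RectFVD.HFree R p.snd p.fst q.fst := fun t ht =>
    RectFVD.pt_mem_freeSpace.1 (hpq ⟨rfl, ht⟩)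
  have hq : q = RectFVD.pt q.fst p.snd := by
    change RectFVD.pt q.fst q.snd = _
    rw [hy]
  refine ⟨?_, ?_⟩
  · rintro fp ⟨hfp, hp⟩ fq ⟨hfq, hq'⟩ h1 - h3 - hnot
    rw [hq] at hq' hnot
    -- If both comparisons were ties, each of the two sites would be farthest from both end points.
    have hlt : RectFVD.geodesicDist R fq p < RectFVD.geodesicDist R fp p ∨
        RectFVD.geodesicDist R fp (RectFVD.pt q.fst p.snd) <
          RectFVD.geodesicDist R fq (RectFVD.pt q.fst p.snd) := by
      by_contra! hle
      rcases hnot with hnot | hnot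
      · exact hnot ⟨hfp, fun s hs => (hq' s hs).trans hle.2⟩
      · exact hnot ⟨hfq, fun s hs => (hp s hs).trans hle.1⟩
    refine RectFVD.fst_lt_of_farther hR' (hS _ hfp) (hS _ hfq) ?_ hx.le hf h1 h3 (hp _ hfq)
      (hq' _ hfp) hlt
    rintro rfl
    exact hlt.elim (lt_irrefl _) (lt_irrefl _)
  · rintro a ⟨ha, ha'⟩ b ⟨hb, hb'⟩ hab s s' hne ⟨hs, has, has'⟩ ⟨hs', hbs, hbs'⟩
    have hf' := hf.mono ha' hb'
    rw [← ha] at hf'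
    have hba : b = RectFVD.pt b.fst a.snd := by
      change RectFVD.pt b.fst b.snd = _
      rw [hb, ha]
    rw [hba] at hbs hbs'
    -- Each site is also reachable at the other point, so it competes for that point and the cell
    -- conditions apply.
    have h1 := hbs.horiz hR' (hS _ hs') hf'.symm
    have h2 := has' s' hs' hne.symm h1
    have h3 := hbs' s hs hne (has.horiz hR' (hS _ hs) hf')
    rw [RectFVD.geodesicDist_comm a, RectFVD.geodesicDist_comm a] at h2
    rw [RectFVD.geodesicDist_comm _ s, RectFVD.geodesicDist_comm _ s'] at h3
    exact RectFVD.fst_lt_of_farther hR' (hS _ hs) (hS _ hs') hne hab.le hf' has h1 h2.le h3.le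
      (.inl h2)
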